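/- All matrices and tensors are real. For $\mathbf A\in\mathbb R^{I\times R}$, $\mathbf B\in\mathbb R^{J\times R}$, $\mathbf C\in\mathbb R^{K\times R}$ with columns $\mathbf a_r,\mathbf b_r,\mathbf c_r$, let $[\mathbf A,\mathbf B,\mathbf C]_R=\sum_{r=1}^R\mathbf a_r\circ\mathbf b_r\circ\mathbf c_r\in\mathbb R^{I\times J\times K}$, where $(\mathbf a\circ\mathbf b\circ\mathbf c)_{ijk}=a_ib_jc_k$. The rank $r_{\mathcal T}$ of a tensor $\mathcal T$ is the least $R$ for which $\mathcal T=[\mathbf A,\mathbf B,\mathbf C]_R$ for some $\mathbf A,\mathbf B,\mathbf C$; such an expression with $R=r_{\mathcal T}$ is a CPD of $\mathcal T$. The CPD of $\mathcal T$ is *unique* if any two CPDs of $\mathcal T$ differ only by a permutation of the $R$ terms and by scalings $\mathbf a_r\mapsto\alpha_r\mathbf a_r$, $\mathbf b_r\mapsto\beta_r\mathbf b_r$, $\mathbf c_r\mapsto\gamma_r\mathbf c_r$ with $\alpha_r\beta_r\gamma_r=1$. Further, $r_{\mathbf C}$ is the rank of $\mathbf C$; $k_{\mathbf C}$ is the largest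 $k$ such that every $k$ columns of $\mathbf C$ are linearly independent; $\mathcal C_m(\mathbf A)$ is the $m$-th compound matrix of $\mathbf A$ (the matrix of its $m\times m$ minors); and $\odot$ is the Khatri–Rao (columnwise Kronecker) product. By an *algebraic procedure* for given sizes $I,J,K,R$ we mean a finite computation tree, depending only on $I,J,K,R$, whose input is the list of entries of a tensor in $\mathbb R^{I\times J\times K}$, whose output is the list of entries of an $I\times R$, a $J\times R$ and a $K\times R$ matrix, and whose steps are: introducing a rational constant; addition, subtraction, multiplication, or division by a nonzero number; branching on whether a computed number is zero; and computing a generalized eigenvalue decomposition (GEVD) of a square pencil $(\mathbf M_1,\mathbf M_2)$ of computed matrices, that is, a nonsingular $\mathbf E$ and a diagonal $\mathbf D$ with $\mathbf M_1\mathbf E=\mathbf M_2\mathbf E\mathbf D$. A GEVD may be requested only if $\mathbf M_2$ is nonsingular and such a real decomposition with pairwise distinct diagonal entries of $\mathbf D$ exists; the order and the scaling of the columns of the returned $\mathbf E$ are arbitrary. The procedure *finds the CPD* of $\mathcal T$ if on input $\mathcal T$ every run, whichever GEVDs are returned, respects these restrictions and outputs the factor matrices of a CPD of $\mathcal T$.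 **Theorem.** Let $I,J,K,R$ be given. There is an algebraic procedure such that the following holds for all $\mathbf A\in\mathbb R^{I\times R}$, $\mathbf B\in\mathbb R^{J\times R}$, $\mathbf C\in\mathbb R^{K\times R}$. Let $\mathcal T=[\mathbf A,\mathbf B,\mathbf C]_R$ and $m=R-r_{\mathbf C}+2$. Suppose that $m\le R$ (that is, $r_{\mathbf C}\ge2$), that $k_{\mathbf C}=r_{\mathbf C}$, and that $\mathcal C_m(\mathbf A)\odot\mathcal C_m(\mathbf B)$ has full column rank. Then (i) $r_{\mathcal T}=R$ and the CPD of $\mathcal T$ is unique; (ii) the CPD of $\mathcal T$ can be found algebraically: the procedure, which does not depend on $\mathbf A,\mathbf B,\mathbf C$, finds the CPD of $\mathcal T$. -/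

import Mathlib

noncomputable section

namespace CPD

/-! ### Matrices -/

/-- The `k`-rank of a matrix: the largest `k`, at most the number of columns, such that every
set of `k` columns (taken at pairwise different positions) is linearly independent. -/
def kRank {K R : ℕ} (M : Matrix (Fin K) (Fin R) ℝ) : ℕ :=
  sSup {k : ℕ | k ≤ R ∧
    ∀ s : Finset (Fin R), s.card = k → LinearIndependent ℝ (fun r : s => M.col (r : Fin R))}

/-- The `k`-th compound matrix, i.e. the matrix of all `k × k` minors.  Rows and columns are
indexed by the strictly increasing `k`-tuples of row and column numbers. -/
def compound (k : ℕ) {p q : ℕ} (M : Matrix (Fin p) (Fin q) ℝ) :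
    Matrix (Fin k ↪o Fin p) (Fin k ↪o Fin q) ℝ :=
  Matrix.of fun i j => (M.submatrix i j).det

/-- The Khatri–Rao (columnwise Kronecker) product. -/
def khatriRao {p q n : Type} (M : Matrix p n ℝ) (N : Matrix q n ℝ) : Matrix (p × q) n ℝ :=
  Matrix.of fun i r => M i.1 r * N i.2 r

/-- A matrix has full column rank: its columns are linearly independent. -/
def FullColumnRank {p n : Type} (M : Matrix p n ℝ) : Prop :=
  LinearIndependent ℝ M.col

/-! ### Third-order tensors and their polyadic decompositions -/

/-- Real `I × J × K` tensors. -/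
abbrev Tensor (I J K : ℕ) : Type := Fin I → Fin J → Fin K → ℝ

/-- `[A, B, C]_R`: the sum over `r` of the outer products of the `r`-th columns. -/
def pd {I J K R : ℕ} (A : Matrix (Fin I) (Fin R) ℝ) (B : Matrix (Fin J) (Fin R) ℝ)
    (C : Matrix (Fin K) (Fin R) ℝ) : Tensor I J K :=
  fun i j k => ∑ r, A i r * B j r * C k r

/-- The rank of a tensor: the least number of terms of a polyadic decomposition.  (Terms with a
zero factor may be left out, so it does not matter that they are not excluded here.) -/
def tensorRank {I J K : ℕ} (T : Tensor I J K) : ℕ :=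
  sInf {R : ℕ | ∃ (A : Matrix (Fin I) (Fin R) ℝ) (B : Matrix (Fin J) (Fin R) ℝ)
    (C : Matrix (Fin K) (Fin R) ℝ), T = pd A B C}

/-- `T = [A, B, C]_R` is a canonical polyadic decomposition: the number `R` of terms is minimal. -/
def IsCPD {I J K R : ℕ} (T : Tensor I J K) (A : Matrix (Fin I) (Fin R) ℝ)
    (B : Matrix (Fin J) (Fin R) ℝ) (C : Matrix (Fin K) (Fin R) ℝ) : Prop :=
  T = pd A B C ∧ tensorRank T = R

/-- The CPD of `T` is unique: any two CPDs of `T` differ only by a permutation of the rank-1 terms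
and by a scaling of the three vectors of each term that leaves the term itself unchanged. -/
def CPDUnique {I J K : ℕ} (T : Tensor I J K) : Prop :=
  ∀ (R : ℕ) (A A' : Matrix (Fin I) (Fin R) ℝ) (B B' : Matrix (Fin J) (Fin R) ℝ)
    (C C' : Matrix (Fin K) (Fin R) ℝ), IsCPD T A B C → IsCPD T A' B' C' →
    ∃ (σ : Equiv.Perm (Fin R)) (α β γ : Fin R → ℝ), ∀ r,
      α r * β r * γ r = 1 ∧
      A'.col r = α r • A.col (σ r) ∧ B'.col r = β r • B.col (σ r) ∧ C'.col r = γ r • C.col (σ r)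

/-! ### Algebraic computation -/

/-- `E` and `d` form a generalized eigenvalue decomposition (GEVD) of the square matrix pencil
`(M₁, M₂)`: the columns of the nonsingular matrix `E` are generalized eigenvectors, with the
generalized eigenvalues `d`. -/
def IsGEVD {N : ℕ} (M₁ M₂ E : Matrix (Fin N) (Fin N) ℝ) (d : Fin N → ℝ) : Prop :=
  IsUnit E.det ∧ M₁ * E = M₂ * E * Matrix.diagonal d

/-- The pencils whose GEVD may be asked for: `M₂` is nonsingular, and the pencil has a real GEVD
with pairwise distinct eigenvalues. -/
def SimplePencil {N : ℕ} (M₁ M₂ : Matrix (Fin N) (Fin N) ℝ) : Prop :=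
  IsUnit M₂.det ∧ ∃ (E : Matrix (Fin N) (Fin N) ℝ) (d : Fin N → ℝ),
    IsGEVD M₁ M₂ E d ∧ Function.Injective d

/-- The four field operations. -/
inductive FieldOp : Type
  | add
  | sub
  | mul
  | div

/-- The result of a field operation. -/
def FieldOp.eval : FieldOp → ℝ → ℝ → ℝ
  | .add, x, y => x + y
  | .sub, x, y => x - y
  | .mul, x, y => x * y
  | .div, x, y => x / y

/-- An algebraic procedure, as a finite computation tree.  It works on real numbers held in
registers, which are indexed by `ι` at the current node, and it returns a family of reals indexed
by `κ`.  A procedure is a syntactic object: it has no access to the contents of the registers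
other than through the steps listed here. -/
inductive Procedure (κ : Type) : Type → Type 1
  /-- Stop and return the contents of the registers `out k`. -/
  | ret {ι : Type} (out : κ → ι) : Procedure κ ι
  /-- Put a rational constant into the new register `none`. -/
  | const {ι : Type} (c : ℚ) (next : Procedure κ (Option ι)) : Procedure κ ι
  /-- Apply a field operation to two registers; the result goes into the new register `none`. -/
  | arith {ι : Type} (op : FieldOp) (i j : ι) (next : Procedure κ (Option ι)) : Procedure κ ι
  /-- Branch according to whether a register is zero. -/
  | ifZero {ι : Type} (i : ι) (yes no : Procedure κ ι) : Procedure κ ι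
  /-- Compute a GEVD of the pencil whose two `N × N` matrices are held in the given registers;
  its eigenvectors and eigenvalues go into new registers. -/
  | gevd {ι : Type} (N : ℕ) (M₁ M₂ : Fin N → Fin N → ι)
      (next : Procedure κ (ι ⊕ ((Fin N × Fin N) ⊕ Fin N))) : Procedure κ ι

/-- `P.Ensures x Q`: started on the register contents `x`, every run of the procedure `P` gets to
its end without a division by zero and without asking for a GEVD of a pencil that is not simple,
and its result satisfies `Q`.  A GEVD step may return any GEVD of its pencil (the order and the
scaling of the eigenvectors are not under control), and all these possibilities have to succeed. -/
def Procedure.Ensures {κ : Type} : {ι : Type} → Procedure κ ι → (ι → ℝ) →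
    ((κ → ℝ) → Prop) → Prop
  | _, .ret out, x, Q => Q fun k => x (out k)
  | _, .const c next, x, Q => next.Ensures (fun o => o.elim (c : ℝ) x) Q
  | _, .arith op i j next, x, Q =>
      (op = FieldOp.div → x j ≠ 0) ∧ next.Ensures (fun o => o.elim (op.eval (x i) (x j)) x) Q
  | _, .ifZero i yes no, x, Q => (x i = 0 → yes.Ensures x Q) ∧ (x i ≠ 0 → no.Ensures x Q)
  | _, .gevd N M₁ M₂ next, x, Q =>
      SimplePencil (Matrix.of fun a b => x (M₁ a b)) (Matrix.of fun a b => x (M₂ a b)) ∧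
      ∀ (E : Matrix (Fin N) (Fin N) ℝ) (d : Fin N → ℝ),
        IsGEVD (Matrix.of fun a b => x (M₁ a b)) (Matrix.of fun a b => x (M₂ a b)) E d →
        next.Ensures (Sum.elim x (Sum.elim (fun p => E p.1 p.2) d)) Q

/-- Procedures whose input is the list of entries of an `I × J × K` tensor and whose output is the
list of entries of an `I × R`, a `J × R` and a `K × R` matrix. -/
abbrev TensorProcedure (I J K R : ℕ) : Type 1 :=
  Procedure ((Fin I × Fin R) ⊕ ((Fin J × Fin R) ⊕ (Fin K × Fin R))) (Fin I × Fin J × Fin K)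

/-- Applied to `T`, the procedure `P` always returns the factor matrices of a CPD of `T`
with `R` terms. -/
def TensorProcedure.FindsCPD {I J K R : ℕ} (P : TensorProcedure I J K R)
    (T : Tensor I J K) : Prop :=
  P.Ensures (fun p => T p.1 p.2.1 p.2.2) fun y =>
    IsCPD T (Matrix.of fun i r => y (Sum.inl (i, r)))
      (Matrix.of fun j r => y (Sum.inr (Sum.inl (j, r))))
      (Matrix.of fun k r => y (Sum.inr (Sum.inr (k, r))))

end CPD

end

noncomputable section

namespace CPD

/-! ### Building procedures -/

/-! Keep `k = r_C` independent rows of `C`. Its columns become vectors `c r` in general position in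
`ℝᵏ`, and the slices combine to `S(x) = ∑ (c r · x) a_r b_rᵀ`. By Cauchy–Binet (`minor_weighted`),
an `m × m` minor of `S(x)` is a combination of the products `∏ (c r · x)` over `m`-sets of indices,
and its coefficients are, up to sign, a row of the Khatri–Rao product of the compounds, or zero.
Full column rank thus makes `rank S(x) < m` force fewer than `m` nonzero values `c r · x`; padding
sharpens this to at most `w` nonzero values when the rank is at most `w < m`
(`Generic.card_support_le`).

Uniqueness: the support of a second decomposition bounds the rank of `S(x)`, hence the support of
the first. Kruskal's permutation lemma (`GeneralPosition.card_le_card_inFlat`) then matches the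
third factors up to scaling. An adjugate formula (`extract_weighted`) isolates `a_r b_rᵀ` from two
combinations of slices, in the same way for both decompositions, and linear independence of these
matrices settles the third factor.

Algorithm: let `d = m - 1`. Each `d`-set `V` has a vertex `b V`, orthogonal to exactly the `k - 1`
vectors `c r` with `r ∉ V`. The minors of `S(x)` span all forms of degree `m` that vanish at the
vertices (`Generic.exists_cell_sum`); the dimension counts fit because `k + d - 1 = R`.
Multiplication by `x_i` from degree `d` to degree `m` modulo the minors, divided by a linear form `v
· x` without zeros at the vertices, has the eigenvectors `∏ (c r · x)`, `r ∈ V`, with eigenvalues `b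
V i / (v · b V)` (`Generic.exists_eigenvectors`). One GEVD yields all vertices,
`Generic.exists_extract` the rank-one terms, and `Generic.exists_recovery` the factors.

Every choice (the rank of `C`, the minors, `v`, the pencil, the labelling of the vertices) is a
finite search with polynomial tests: some candidate passes, and any that passes is good enough. The
last test compares the candidate with the tensor, which suffices because the rank is known to be
`R`. -/

/-- Run a procedure on a larger set of registers. -/
def Procedure.rename {κ : Type} : {ι ι' : Type} → Procedure κ ι → (ι → ι') → Procedure κ ι'
  | _, _, .ret out, g => .ret fun k => g (out k)
  | _, _, .const c next, g => .const c (next.rename (Option.map g))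
  | _, _, .arith op i j next, g => .arith op (g i) (g j) (next.rename (Option.map g))
  | _, _, .ifZero i yes no, g => .ifZero (g i) (yes.rename g) (no.rename g)
  | _, _, .gevd N M₁ M₂ next, g =>
      .gevd N (fun a b => g (M₁ a b)) (fun a b => g (M₂ a b)) (next.rename (Sum.map g id))

theorem Procedure.ensures_rename {κ ι : Type} (P : Procedure κ ι) :
    ∀ {ι' : Type} (g : ι → ι') (y : ι' → ℝ) (Q : (κ → ℝ) → Prop),
      (P.rename g).Ensures y Q ↔ P.Ensures (fun i => y (g i)) Q := by
  induction P with
  | ret out => intro ι' g y Q; rfl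
  | const c next ih =>
    intro ι' g y Q
    simp only [Procedure.rename, Procedure.Ensures, ih]
    rw [iff_iff_eq]
    congr 1
    funext o
    cases o <;> rfl
  | arith op i j next ih =>
    intro ι' g y Q
    simp only [Procedure.rename, Procedure.Ensures, ih]
    rw [iff_iff_eq]
    congr 2
    funext o
    cases o <;> rfl
  | ifZero i yes no ih₁ ih₂ =>
    intro ι' g y Q
    simp only [Procedure.rename, Procedure.Ensures, ih₁, ih₂]
  | gevd N M₁ M₂ next ih =>
    intro ι' g y Q
    simp only [Procedure.rename, Procedure.Ensures, ih]
    have h : ∀ (E : Matrix (Fin N) (Fin N) ℝ) (d : Fin N → ℝ),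
        (fun i => Sum.elim y (Sum.elim (fun p : Fin N × Fin N => E p.1 p.2) d) (Sum.map g id i))
          = Sum.elim (fun i => y (g i)) (Sum.elim (fun p : Fin N × Fin N => E p.1 p.2) d) := by
      intro E d
      funext o
      rcases o with o | o <;> rfl
    simp only [h]

/-- A function of the registers that a procedure can compute without divisions. -/
def Computes {ι : Type} (f : (ι → ℝ) → ℝ) : Prop :=
  ∀ (κ ι' : Type) (g : ι → ι') (next : Procedure κ (Option ι')), ∃ P : Procedure κ ι',
    ∀ (y : ι' → ℝ) (Q : (κ → ℝ) → Prop),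
      next.Ensures (fun o => o.elim (f fun i => y (g i)) y) Q → P.Ensures y Q

namespace Computes

variable {ι : Type}

theorem proj (i : ι) : Computes fun x : ι → ℝ => x i := by
  intro κ ι' g next
  refine ⟨next.rename fun o => o.elim (g i) id, fun y Q h => ?_⟩
  rw [Procedure.ensures_rename]
  convert h using 1
  funext o
  cases o <;> rfl

theorem rat (c : ℚ) : Computes fun _ : ι → ℝ => (c : ℝ) :=
  fun _ _ _ next => ⟨.const c next, fun _ _ h => h⟩

/-- The second operand is computed on registers already enlarged by the first, so at the operation
`f` sits in `some none` and `h` in `none`. This is what the arbitrary register map in `Computes` is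
for. -/
theorem arith {f h : (ι → ℝ) → ℝ} (op : FieldOp) (hop : op ≠ FieldOp.div)
    (hf : Computes f) (hh : Computes h) : Computes fun x => op.eval (f x) (h x) := by
  intro κ ι' g next
  obtain ⟨P₁, h₁⟩ := hh κ (Option ι') (fun i => some (g i))
    (.arith op (some none) none (next.rename (Option.map fun i => some (some i))))
  obtain ⟨P, h₂⟩ := hf κ ι' g P₁
  refine ⟨P, fun y Q hy => h₂ y Q (h₁ _ Q ⟨fun h => absurd h hop, ?_⟩)⟩
  rw [Procedure.ensures_rename]
  convert hy using 1
  funext o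
  cases o <;> rfl

theorem add {f h : (ι → ℝ) → ℝ} (hf : Computes f) (hh : Computes h) :
    Computes fun x => f x + h x :=
  arith FieldOp.add (by simp) hf hh

theorem sub {f h : (ι → ℝ) → ℝ} (hf : Computes f) (hh : Computes h) :
    Computes fun x => f x - h x :=
  arith FieldOp.sub (by simp) hf hh

theorem mul {f h : (ι → ℝ) → ℝ} (hf : Computes f) (hh : Computes h) :
    Computes fun x => f x * h x :=
  arith FieldOp.mul (by simp) hf hh

theorem sum {α : Type*} (s : Finset α) {f : α → (ι → ℝ) → ℝ} (hf : ∀ a, Computes (f a)) :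
    Computes fun x => ∑ a ∈ s, f a x := by
  classical
  induction s using Finset.induction_on with
  | empty => simpa using rat (ι := ι) 0
  | insert a s ha ih => simpa [Finset.sum_insert ha] using add (hf a) ih

theorem prod {α : Type*} (s : Finset α) {f : α → (ι → ℝ) → ℝ} (hf : ∀ a, Computes (f a)) :
    Computes fun x => ∏ a ∈ s, f a x := by
  classical
  induction s using Finset.induction_on with
  | empty => simpa using rat (ι := ι) 1
  | insert a s ha ih => simpa [Finset.prod_insert ha] using mul (hf a) ih

theorem det {α : Type*} [Fintype α] [DecidableEq α] {M : (ι → ℝ) → Matrix α α ℝ}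
    (hM : ∀ a b, Computes fun x => M x a b) : Computes fun x => (M x).det := by
  simp only [Matrix.det_apply']
  refine sum _ fun σ => mul ?_ (prod _ fun i => hM _ _)
  simpa using rat (ι := ι) ((Equiv.Perm.sign σ : ℤ) : ℚ)

theorem matrix_mul {α β γ : Type*} [Fintype β] {M : (ι → ℝ) → Matrix α β ℝ}
    {M' : (ι → ℝ) → Matrix β γ ℝ} (hM : ∀ a b, Computes fun x => M x a b)
    (hM' : ∀ a b, Computes fun x => M' x a b) (a : α) (c : γ) :
    Computes fun x => (M x * M' x) a c := by
  simp only [Matrix.mul_apply]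
  exact sum _ fun b => mul (hM _ _) (hM' _ _)

/-- Adjugates replace inverses in all computed quantities, so that no division is needed before the
final step. -/
theorem adjugate {α : Type*} [Fintype α] [DecidableEq α] {M : (ι → ℝ) → Matrix α α ℝ}
    (hM : ∀ a b, Computes fun x => M x a b) (a b : α) : Computes fun x => (M x).adjugate a b := by
  simp only [Matrix.adjugate_apply]
  refine det fun i j => ?_
  by_cases h : i = b
  · subst h
    by_cases h' : j = a
    · subst h'
      simpa using rat (ι := ι) 1
    · simpa [h'] using rat (ι := ι) 0
  · simpa [h] using hM i j

theorem matrix_pow {α : Type*} [Fintype α] [DecidableEq α] {M : (ι → ℝ) → Matrix α α ℝ}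
    (hM : ∀ a b, Computes fun x => M x a b) (n : ℕ) (a b : α) :
    Computes fun x => (M x ^ n) a b := by
  induction n generalizing a b with
  | zero =>
    by_cases h : a = b
    · simpa [h] using rat (ι := ι) 1
    · simpa [h] using rat (ι := ι) 0
  | succ n ih =>
    simp only [pow_succ]
    exact matrix_mul ih hM a b

theorem comap {ι₀ : Type} {f : (ι₀ → ℝ) → ℝ} (hf : Computes f) (g : ι₀ → ι) :
    Computes fun x : ι → ℝ => f fun i => x (g i) :=
  fun κ ι' g' next => hf κ ι' (fun i => g' (g i)) next

theorem family {α : Type} [Finite α] {f : α → (ι → ℝ) → ℝ} (hf : ∀ a, Computes (f a))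
    {κ : Type} (next : Procedure κ (ι ⊕ α)) :
    ∃ P : Procedure κ ι, ∀ (x : ι → ℝ) (Q : (κ → ℝ) → Prop),
      next.Ensures (Sum.elim x fun a => f a x) Q → P.Ensures x Q := by
  -- The register map is generalized because the induction computes one value at a time and each
  -- adds a register.
  suffices H : ∀ (α : Type) [Finite α] (ι' : Type) (g : ι → ι') (f : α → (ι → ℝ) → ℝ),
      (∀ a, Computes (f a)) → ∀ next : Procedure κ (ι' ⊕ α),
      ∃ P : Procedure κ ι', ∀ (y : ι' → ℝ) (Q : (κ → ℝ) → Prop),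
      next.Ensures (Sum.elim y fun a => f a fun i => y (g i)) Q → P.Ensures y Q from
    H α ι id f hf next
  intro α _
  induction α using Finite.induction_empty_option with
  | of_equiv e ih =>
    rename_i α β
    intro ι' g f hf next
    obtain ⟨P, hP⟩ := ih ι' g (fun a => f (e a)) (fun a => hf _)
      (next.rename (Sum.map id e.symm))
    refine ⟨P, fun y Q h => hP y Q ?_⟩
    rw [Procedure.ensures_rename]
    convert h using 1
    funext o
    rcases o with o | o <;> simp
  | h_empty =>
    intro ι' g f hf next
    refine ⟨next.rename (Sum.elim id PEmpty.elim), fun y Q h => ?_⟩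
    rw [Procedure.ensures_rename]
    convert h using 1
    funext o
    rcases o with o | o
    · rfl
    · exact o.elim
  | h_option ih =>
    rename_i α _
    intro ι' g f hf next
    obtain ⟨P₁, h₁⟩ := ih (Option ι') (fun i => some (g i)) (fun a => f (some a))
      (fun a => hf _) (next.rename (Sum.elim (fun i => Sum.inl (some i))
        fun o => o.elim (Sum.inl none) Sum.inr))
    obtain ⟨P, hP⟩ := hf none κ ι' g P₁
    refine ⟨P, fun y Q h => hP y Q (h₁ _ Q ?_)⟩
    rw [Procedure.ensures_rename]
    convert h using 1
    funext o
    rcases o with o | o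
    · rfl
    · cases o <;> rfl

end Computes

/-- A set of register contents that a procedure can branch on. -/
def Decides {ι : Type} (U : Set (ι → ℝ)) : Prop :=
  ∀ (κ : Type) (P Q : Procedure κ ι), ∃ S : Procedure κ ι,
    ∀ (x : ι → ℝ) (post : (κ → ℝ) → Prop), (x ∈ U → P.Ensures x post) →
      (x ∉ U → Q.Ensures x post) → S.Ensures x post

namespace Decides

variable {ι : Type}

theorem eq_zero {f : (ι → ℝ) → ℝ} (hf : Computes f) : Decides {x | f x = 0} := by
  intro κ P Q
  obtain ⟨S, hS⟩ := hf κ ι id (.ifZero none (P.rename some) (Q.rename some))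
  refine ⟨S, fun x post hP hQ => hS x post ⟨fun h => ?_, fun h => ?_⟩⟩
  · exact (Procedure.ensures_rename _ _ _ _).2 (hP h)
  · exact (Procedure.ensures_rename _ _ _ _).2 (hQ h)

theorem compl {U : Set (ι → ℝ)} (hU : Decides U) : Decides {x | x ∉ U} := by
  intro κ P Q
  obtain ⟨S, hS⟩ := hU κ Q P
  exact ⟨S, fun x post hP hQ => hS x post (fun h => hQ (not_not_intro h)) hP⟩

theorem ne_zero {f : (ι → ℝ) → ℝ} (hf : Computes f) : Decides {x | f x ≠ 0} :=
  compl (eq_zero hf)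

theorem eq {f h : (ι → ℝ) → ℝ} (hf : Computes f) (hh : Computes h) :
    Decides {x | f x = h x} := by
  simpa [sub_eq_zero] using eq_zero (hf.sub hh)

theorem and {p q : (ι → ℝ) → Prop} (hp : Decides {x | p x}) (hq : Decides {x | q x}) :
    Decides {x | p x ∧ q x} := by
  intro κ P Q
  obtain ⟨S₁, h₁⟩ := hq κ P Q
  obtain ⟨S, hS⟩ := hp κ S₁ Q
  refine ⟨S, fun x post hP hQ => hS x post (fun h => h₁ x post (fun h' => hP ⟨h, h'⟩)
    fun h' => hQ fun h'' => h' h''.2) fun h => hQ fun h'' => h h''.1⟩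

theorem forall_finite {α : Type*} [Finite α] {p : α → (ι → ℝ) → Prop}
    (hp : ∀ a, Decides {x | p a x}) : Decides {x | ∀ a, p a x} := by
  classical
  have := Fintype.ofFinite α
  have H : ∀ s : Finset α, Decides {x | ∀ a ∈ s, p a x} := by
    intro s
    induction s using Finset.induction_on with
    | empty => exact fun κ P Q => ⟨P, fun x post hP _ => hP (by simp)⟩
    | insert a s _ ih => simpa using (hp a).and ih
  simpa using H Finset.univ

end Decides

/-- Some procedure turns every register contents `x ∈ D` into a result that satisfies `Post x`. -/
def Realizable {κ ι : Type} (D : Set (ι → ℝ)) (Post : (ι → ℝ) → (κ → ℝ) → Prop) : Prop :=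
  ∃ P : Procedure κ ι, ∀ x ∈ D, P.Ensures x (Post x)

namespace Realizable

variable {κ ι : Type} {D : Set (ι → ℝ)} {Post : (ι → ℝ) → (κ → ℝ) → Prop}

theorem of_computes [Finite κ] (f : κ → (ι → ℝ) → ℝ) (hf : ∀ a, Computes (f a))
    (h : ∀ x ∈ D, Post x fun a => f a x) : Realizable D Post := by
  obtain ⟨P, hP⟩ := Computes.family hf (.ret Sum.inr)
  exact ⟨P, fun x hx => hP x _ (h x hx)⟩

/-- Try finitely many procedures, each of which comes with a test for its applicability. -/
theorem of_cases {α : Type*} [Finite α] (p : α → (ι → ℝ) → Prop) (hp : ∀ a, Decides {x | p a x})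
    (hD : ∀ x ∈ D, ∃ a, p a x) (h : ∀ a, Realizable {x | x ∈ D ∧ p a x} Post) :
    Realizable D Post := by
  classical
  by_cases hα : Nonempty α
  swap
  -- Without candidates `D` is empty, but a procedure must still be exhibited. As `ι` may be empty,
  -- a constant supplies the register to return.
  · obtain ⟨P, -⟩ : ∃ P : Procedure κ (Option ι), True := by
      exact ⟨.ret fun _ => none, trivial⟩
    refine ⟨.const 0 P, fun x hx => ?_⟩
    obtain ⟨a, -⟩ := hD x hx
    exact absurd ⟨a⟩ hα
  have := Fintype.ofFinite α
  choose P hP using h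
  have H : ∀ s : Finset α, ∃ S : Procedure κ ι, ∀ x ∈ D, (∃ a ∈ s, p a x) →
      S.Ensures x (Post x) := by
    intro s
    induction s using Finset.induction_on with
    | empty => exact ⟨P hα.some, fun x _ h => by simp at h⟩
    | insert a s _ ih =>
      obtain ⟨S, hS⟩ := ih
      obtain ⟨S', hS'⟩ := hp a κ (P a) S
      refine ⟨S', fun x hx h => hS' x _ (fun ha => hP a x ⟨hx, ha⟩) fun ha => hS x hx ?_⟩
      obtain ⟨b, hb, hb'⟩ := h
      rcases Finset.mem_insert.1 hb with rfl | hb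
      · exact absurd hb' ha
      · exact ⟨b, hb, hb'⟩
  obtain ⟨S, hS⟩ := H Finset.univ
  exact ⟨S, fun x hx => hS x hx (by simpa using hD x hx)⟩

/-- Put the inverse of a computed nonzero number into a register. -/
theorem of_inv {f : (ι → ℝ) → ℝ} (hf : Computes f) (hD : ∀ x ∈ D, f x ≠ 0)
    (h : Realizable {y : Option ι → ℝ | (fun i => y (some i)) ∈ D ∧
      y none = (f fun i => y (some i))⁻¹} fun y => Post fun i => y (some i)) :
    Realizable D Post := by
  obtain ⟨P, hP⟩ := h
  -- The only division of the whole procedure: `none` holds `1` and `some none` the value of `f`.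
  obtain ⟨S, hS⟩ := hf κ ι id (.const 1 (.arith .div none (some none)
    (P.rename (Option.map fun i => some (some i)))))
  refine ⟨S, fun x hx => hS x _ ⟨fun _ => hD x hx, ?_⟩⟩
  rw [Procedure.ensures_rename]
  refine hP _ ⟨hx, ?_⟩
  simp [FieldOp.eval]

/-- Only the eigenvector registers are passed on. What follows may rely on nothing but their
belonging to some GEVD of the pencil, since order and scaling are arbitrary. -/
theorem of_gevd {N : ℕ} {M₁ M₂ : (ι → ℝ) → Matrix (Fin N) (Fin N) ℝ}
    (h₁ : ∀ a b, Computes fun x => M₁ x a b) (h₂ : ∀ a b, Computes fun x => M₂ x a b)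
    (hD : ∀ x ∈ D, SimplePencil (M₁ x) (M₂ x))
    (h : Realizable {y : ι ⊕ (Fin N × Fin N) → ℝ | (fun i => y (Sum.inl i)) ∈ D ∧
      ∃ d, IsGEVD (M₁ fun i => y (Sum.inl i)) (M₂ fun i => y (Sum.inl i))
        (Matrix.of fun a b => y (Sum.inr (a, b))) d} fun y => Post fun i => y (Sum.inl i)) :
    Realizable D Post := by
  obtain ⟨P, hP⟩ := h
  have hc : ∀ o : (Fin N × Fin N) ⊕ (Fin N × Fin N), Computes fun x : ι → ℝ =>
      Sum.elim (fun p => M₁ x p.1 p.2) (fun p => M₂ x p.1 p.2) o := by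
    rintro (p | p)
    · exact h₁ _ _
    · exact h₂ _ _
  obtain ⟨S, hS⟩ := Computes.family hc (.gevd N (fun a b => Sum.inr (Sum.inl (a, b)))
    (fun a b => Sum.inr (Sum.inr (a, b))) (P.rename (Sum.map Sum.inl Sum.inl)))
  refine ⟨S, fun x hx => hS x _ ⟨hD x hx, fun E d hE => ?_⟩⟩
  rw [Procedure.ensures_rename]
  exact hP _ ⟨hx, d, hE⟩

end Realizable

open Matrix

/-! ### Linear algebra -/

/-- Vectors `f a` that are not all orthogonal to a nonzero vector contain a basis. -/
theorem exists_det_ne_zero {α β : Type*} [Fintype β] [DecidableEq β] (f : α → β → ℝ)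
    (h : ∀ w : β → ℝ, (∀ a, ∑ b, f a b * w b = 0) → w = 0) :
    ∃ g : β → α, (Matrix.of fun b => f (g b)).det ≠ 0 := by
  have htop : Submodule.span ℝ (Set.range f) = ⊤ := by
    by_contra hne
    obtain ⟨φ, hφ, hle⟩ := Submodule.exists_le_ker_of_lt_top _ (lt_top_iff_ne_top.2 hne)
    have hφ' : ∀ v : β → ℝ, φ v = ∑ b, v b * φ (fun j => if b = j then 1 else 0) := fun v => by
      simpa using LinearMap.pi_apply_eq_sum_univ φ v
    have hw := h (fun b => φ (fun j => if b = j then 1 else 0)) fun a => by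
      rw [← hφ']
      exact hle (Submodule.subset_span ⟨a, rfl⟩)
    refine hφ (LinearMap.ext fun v => ?_)
    rw [hφ']
    simp [fun b => congrFun hw b]
  obtain ⟨g, hg, hs, hi⟩ := Submodule.exists_fun_fin_finrank_span_eq ℝ (Set.range f)
  have hcard : Module.finrank ℝ (Submodule.span ℝ (Set.range f)) = Fintype.card β := by
    rw [htop, finrank_top, Module.finrank_fintype_fun_eq_card]
  let e : β ≃ Fin (Module.finrank ℝ (Submodule.span ℝ (Set.range f))) :=
    (Fintype.equivFin β).trans (finCongr hcard.symm)
  choose a ha using fun b => hg (e b)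
  refine ⟨a, ?_⟩
  have hli : LinearIndependent ℝ (Matrix.of fun b => f (a b)).row := by
    change LinearIndependent ℝ fun b => f (a b)
    rw [funext ha]
    exact hi.comp e e.injective
  rw [Matrix.linearIndependent_rows_iff_isUnit, Matrix.isUnit_iff_isUnit_det] at hli
  exact hli.ne_zero

/-- The Cauchy–Binet formula. -/
theorem det_mul_eq_sum_minors {m R : ℕ} (M : Matrix (Fin m) (Fin R) ℝ)
    (N : Matrix (Fin R) (Fin m) ℝ) :
    (M * N).det = ∑ U : Fin m ↪o Fin R, (M.submatrix id U).det * (N.submatrix U id).det := by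
  have h₁ : (M * N).det = ∑ p : Fin m → Fin R, (∏ i, M i (p i)) * (N.submatrix p id).det := by
    have h : (M * N) = fun i => ∑ r, M i r • N r := by
      funext i j
      simp [Matrix.mul_apply, Finset.sum_apply]
    change Matrix.detRowAlternating.toMultilinearMap (M * N) = _
    rw [h, MultilinearMap.map_sum]
    refine Finset.sum_congr rfl fun p _ => ?_
    rw [MultilinearMap.map_smul_univ]
    rfl
  -- An injective index tuple is uniquely an increasing tuple composed with a permutation; the other
  -- tuples repeat a row and contribute zero.
  have hinj : Function.Injective fun q : (Fin m ↪o Fin R) × Equiv.Perm (Fin m) =>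
      fun i => q.1 (q.2 i) := by
    rintro ⟨U, σ⟩ ⟨U', σ'⟩ h
    have hU : U = U' := by
      rw [← OrderEmbedding.range_inj]
      have h' : (U : Fin m → Fin R) ∘ σ = U' ∘ σ' := h
      rw [← σ.surjective.range_comp U, ← σ'.surjective.range_comp U', h']
    subst hU
    simp only [Prod.mk.injEq, true_and]
    ext i
    exact congrArg _ (U.injective (congrFun h i))
  have h₂ : ∑ q : (Fin m ↪o Fin R) × Equiv.Perm (Fin m),
      (∏ i, M i (q.1 (q.2 i))) * (N.submatrix (fun i => q.1 (q.2 i)) id).det =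
      ∑ p : Fin m → Fin R, (∏ i, M i (p i)) * (N.submatrix p id).det := by
    refine Fintype.sum_of_injective _ hinj _ _ (fun p hp => ?_) fun q => rfl
    have hp' : ¬ Function.Injective p := by
      intro hp'
      refine hp ⟨(OrderEmbedding.ofStrictMono (p ∘ Tuple.sort p)
        ((Tuple.monotone_sort p).strictMono_of_injective
          (hp'.comp (Tuple.sort p).injective)), (Tuple.sort p)⁻¹), ?_⟩
      funext i
      simp
    rw [Function.not_injective_iff] at hp'
    obtain ⟨i, j, hij, hne⟩ := hp'
    rw [Matrix.det_zero_of_row_eq hne, mul_zero]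
    funext l
    simp [hij]
  rw [h₁, ← h₂, Fintype.sum_prod_type]
  refine Finset.sum_congr rfl fun U _ => ?_
  rw [← Matrix.det_transpose, Matrix.det_apply', Finset.sum_mul]
  refine Finset.sum_congr rfl fun σ _ => ?_
  have : N.submatrix (fun i => U (σ i)) id = (N.submatrix U id).submatrix σ id := rfl
  simp only [this, Matrix.det_permute, Matrix.transpose_apply, Matrix.submatrix_apply, id]
  ring

theorem rank_add_le {α β : Type*} [Fintype β] (M N : Matrix α β ℝ) [Finite α] :
    (M + N).rank ≤ M.rank + N.rank := by
  have := Fintype.ofFinite α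
  unfold Matrix.rank
  rw [Matrix.mulVecLin_add]
  calc _ ≤ Module.finrank ℝ (↥(LinearMap.range M.mulVecLin ⊔ LinearMap.range N.mulVecLin)) := by
        refine Submodule.finrank_mono ?_
        rintro _ ⟨x, rfl⟩
        exact Submodule.add_mem_sup ⟨x, rfl⟩ ⟨x, rfl⟩
    _ ≤ _ := Submodule.finrank_add_le_finrank_add_finrank _ _

theorem le_rank_of_minor {m : ℕ} {α β : Type*} [Fintype α] [Fintype β] (M : Matrix α β ℝ)
    (e : Fin m → α) (e' : Fin m → β) (h : (M.submatrix e e').det ≠ 0) : m ≤ M.rank := by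
  classical
  have h₁ : M.submatrix e e' =
      (1 : Matrix α α ℝ).submatrix e id * M * (1 : Matrix β β ℝ).submatrix id e' := by
    ext i j
    simp [Matrix.mul_apply, Matrix.one_apply]
  calc m = (M.submatrix e e').rank := by rw [Matrix.rank_of_det_ne_zero h, Fintype.card_fin]
    _ ≤ M.rank := by
      rw [h₁]
      exact (Matrix.rank_mul_le_left _ _).trans (Matrix.rank_mul_le_right _ _)

/-! ### Weighted sums of rank-one matrices -/

/-- The matrix `∑ r, d r • a_r b_rᵀ`. -/
def weighted {α β ρ : Type*} [Fintype ρ] (A : Matrix α ρ ℝ) (B : Matrix β ρ ℝ) (d : ρ → ℝ) :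
    Matrix α β ℝ :=
  Matrix.of fun i j => ∑ r, A i r * B j r * d r

section Weighted

variable {α β ρ : Type*} [Fintype ρ] (A : Matrix α ρ ℝ) (B : Matrix β ρ ℝ)

theorem weighted_apply (d : ρ → ℝ) (i : α) (j : β) :
    weighted A B d i j = ∑ r, A i r * B j r * d r := rfl

theorem weighted_eq_mul [DecidableEq ρ] (d : ρ → ℝ) :
    weighted A B d = A * diagonal d * Bᵀ := by
  ext i j
  rw [Matrix.mul_apply]
  simp only [weighted_apply, Matrix.mul_diagonal, Matrix.transpose_apply]
  exact Finset.sum_congr rfl fun r _ => by ring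

theorem weighted_add (d d' : ρ → ℝ) : weighted A B (d + d') = weighted A B d + weighted A B d' := by
  ext i j
  simp [weighted_apply, mul_add, Finset.sum_add_distrib]

theorem rank_weighted_le [Fintype α] [Fintype β] (d : ρ → ℝ) :
    (weighted A B d).rank ≤ (Finset.univ.filter fun r => d r ≠ 0).card := by
  classical
  rw [weighted_eq_mul]
  refine ((Matrix.rank_mul_le_left _ _).trans (Matrix.rank_mul_le_right _ _)).trans ?_
  rw [Matrix.rank_diagonal, Fintype.card_subtype]

/-- Cauchy–Binet for `A * diagonal d * Bᵀ`. It links ranks to the Khatri–Rao hypothesis: the weights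
enter only through their `m`-fold products. -/
theorem minor_weighted {m R : ℕ} (A : Matrix α (Fin R) ℝ) (B : Matrix β (Fin R) ℝ)
    (d : Fin R → ℝ) (e : Fin m → α) (e' : Fin m → β) :
    ((weighted A B d).submatrix e e').det = ∑ U : Fin m ↪o Fin R,
      (∏ i, d (U i)) * ((A.submatrix e U).det * (B.submatrix e' U).det) := by
  have h : (weighted A B d).submatrix e e' =
      (A.submatrix e id) * (diagonal d * (B.submatrix e' id)ᵀ) := by
    rw [weighted_eq_mul, Matrix.mul_assoc]
    rfl
  rw [h, det_mul_eq_sum_minors]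
  refine Finset.sum_congr rfl fun U _ => ?_
  have h' : (diagonal d * (B.submatrix e' id)ᵀ).submatrix U id =
      diagonal (fun i => d (U i)) * (B.submatrix e' U)ᵀ := by
    ext i j
    simp [Matrix.diagonal_mul]
  rw [h', Matrix.det_mul, Matrix.det_diagonal, Matrix.det_transpose]
  simp only [Matrix.submatrix_submatrix, Function.comp_def, id]
  ring

theorem weighted_of_support {μ : Type*} [Fintype μ] {U : μ → ρ} (hU : Function.Injective U)
    {d : ρ → ℝ} (hd : ∀ r, r ∉ Set.range U → d r = 0) :
    weighted A B d = weighted (A.submatrix id U) (B.submatrix id U) fun i => d (U i) := by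
  ext i j
  simp only [weighted_apply]
  refine (Fintype.sum_of_injective U hU _ _ (fun r hr => ?_) fun _ => rfl).symm
  rw [hd r hr, mul_zero]

/-- The rank-one term that is missing from `M₁ = ∑ d₁ r • a_r b_rᵀ`, up to a factor. -/
def extract {μ : Type*} [Fintype μ] [DecidableEq μ] (M₀ M₁ : Matrix α β ℝ) (e : μ → α)
    (e' : μ → β) : Matrix α β ℝ :=
  M₀.submatrix id e' * (M₁.submatrix e e').adjugate * M₀.submatrix e id

/-- Restricted to `U`, the minor of the second matrix factors as `P * diagonal * Sᵀ`. Since the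
diagonal vanishes at `a`, its adjugate has at most the entry at `(a, a)`. The outer factors `P` and
`Sᵀ` meet their own adjugates and collapse to determinants, so no invertibility is needed. -/
theorem extract_weighted {μ : Type*} [Fintype μ] [DecidableEq μ] {U : μ → ρ}
    (hU : Function.Injective U) {d₀ d₁ : ρ → ℝ} (h₀ : ∀ r, r ∉ Set.range U → d₀ r = 0)
    (h₁ : ∀ r, r ∉ Set.range U → d₁ r = 0) (a : μ) (ha : d₁ (U a) = 0) (e : μ → α) (e' : μ → β)
    (i : α) (j : β) :
    extract (weighted A B d₀) (weighted A B d₁) e e' i j =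
      (A.submatrix e U).det * (B.submatrix e' U).det * d₀ (U a) ^ 2 *
        (∏ b ∈ Finset.univ.erase a, d₁ (U b)) * (A i (U a) * B j (U a)) := by
  have hW : ∀ (A' : Matrix α μ ℝ) (B' : Matrix β μ ℝ) (d : μ → ℝ) (f : μ → α) (f' : μ → β),
      (weighted A' B' d).submatrix f f' =
      A'.submatrix f id * diagonal d * (B'.submatrix f' id)ᵀ := by
    intro A' B' d f f'
    rw [weighted_eq_mul]
    rfl
  have hl : ∀ (A' : Matrix α μ ℝ) (B' : Matrix β μ ℝ) (d : μ → ℝ) (f' : μ → β),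
      (weighted A' B' d).submatrix id f' = A' * diagonal d * (B'.submatrix f' id)ᵀ := by
    intro A' B' d f'
    rw [weighted_eq_mul]
    rfl
  have hr : ∀ (A' : Matrix α μ ℝ) (B' : Matrix β μ ℝ) (d : μ → ℝ) (f : μ → α),
      (weighted A' B' d).submatrix f id = A'.submatrix f id * diagonal d * B'ᵀ := by
    intro A' B' d f
    rw [weighted_eq_mul]
    rfl
  rw [extract, weighted_of_support A B hU h₀, weighted_of_support A B hU h₁, hW, hl, hr]
  set A' := A.submatrix id U
  set B' := B.submatrix id U
  have hA : A.submatrix e U = A'.submatrix e id := rfl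
  have hB : B.submatrix e' U = B'.submatrix e' id := rfl
  rw [hA, hB]
  set P := A'.submatrix e id
  set S := B'.submatrix e' id
  rw [Matrix.adjugate_mul_distrib, Matrix.adjugate_mul_distrib, Matrix.adjugate_diagonal]
  have hprod : ∀ b, b ≠ a → ∏ x ∈ Finset.univ.erase b, d₁ (U x) = 0 := fun b hb =>
    Finset.prod_eq_zero (Finset.mem_erase.2 ⟨hb.symm, Finset.mem_univ a⟩) ha
  have hassoc : A' * diagonal (fun i => d₀ (U i)) * Sᵀ * (Sᵀ.adjugate *
      (diagonal (fun b => ∏ x ∈ Finset.univ.erase b, d₁ (U x)) * P.adjugate)) *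
      (P * diagonal (fun i => d₀ (U i)) * B'ᵀ) = A' * diagonal (fun i => d₀ (U i)) *
      (Sᵀ * Sᵀ.adjugate) * diagonal (fun b => ∏ x ∈ Finset.univ.erase b, d₁ (U x)) *
      (P.adjugate * P) * diagonal (fun i => d₀ (U i)) * B'ᵀ := by
    simp only [Matrix.mul_assoc]
  rw [hassoc, Matrix.mul_adjugate, Matrix.adjugate_mul, Matrix.det_transpose]
  simp only [Matrix.mul_smul, Matrix.smul_mul, Matrix.mul_one, Matrix.smul_apply, smul_eq_mul]
  rw [Matrix.mul_apply, Finset.sum_eq_single a]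
  · simp only [Matrix.mul_diagonal, Matrix.transpose_apply, A', B', Matrix.submatrix_apply, id]
    ring
  · intro b _ hb
    rw [Matrix.mul_diagonal, Matrix.mul_diagonal, hprod b hb]
    ring
  · simp

end Weighted

/-! ### Vectors in general position -/

theorem exists_ne_zero_orthogonal {ρ : Type*} {k : ℕ} (c : ρ → Fin k → ℝ) (S : Finset ρ)
    (hS : S.card < k) : ∃ x : Fin k → ℝ, x ≠ 0 ∧ ∀ r ∈ S, c r ⬝ᵥ x = 0 := by
  let f : (Fin k → ℝ) →ₗ[ℝ] (S → ℝ) := LinearMap.pi fun r => dotProductBilin ℝ ℝ (c r)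
  have hf : LinearMap.ker f ≠ ⊥ := LinearMap.ker_ne_bot_of_finrank_lt (by simpa using hS)
  obtain ⟨x, hx, hx0⟩ := Submodule.exists_mem_ne_zero_of_ne_bot hf
  refine ⟨x, hx0, fun r hr => ?_⟩
  have := congrFun (LinearMap.mem_ker.1 hx) ⟨r, hr⟩
  simpa [f] using this

/-- Every `k` of the vectors `c r` in `ℝᵏ` are linearly independent: fewer than `k` of them are
orthogonal to any given nonzero vector. -/
def GeneralPosition {R k : ℕ} (c : Fin R → Fin k → ℝ) : Prop :=
  ∀ x : Fin k → ℝ, x ≠ 0 → (Finset.univ.filter fun r => c r ⬝ᵥ x = 0).card < k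

/-- Fewer than `k` vectors have a common nonzero orthogonal vector, and general position forbids a
`k`-th vector orthogonal to it. -/
theorem GeneralPosition.exists_orthogonal_iff {R k : ℕ} {c : Fin R → Fin k → ℝ}
    (h : GeneralPosition c) {S : Finset (Fin R)} (hS : S.card + 1 = k) :
    ∃ x : Fin k → ℝ, x ≠ 0 ∧ ∀ r, c r ⬝ᵥ x = 0 ↔ r ∈ S := by
  obtain ⟨x, hx, hxS⟩ := exists_ne_zero_orthogonal c S (by omega)
  refine ⟨x, hx, fun r => ⟨fun hr => ?_, hxS r⟩⟩
  by_contra hrS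
  have h₁ : insert r S ⊆ Finset.univ.filter fun r => c r ⬝ᵥ x = 0 := by
    intro q hq
    rcases Finset.mem_insert.1 hq with rfl | hq
    · simpa using hr
    · simpa using hxS q hq
  have h₂ := Finset.card_le_card h₁
  rw [Finset.card_insert_of_notMem hrS] at h₂
  have := h x hx
  omega

/-- `v` lies in the span of the vectors `c q`, `q ∈ W`. -/
def InFlat {R k : ℕ} (c : Fin R → Fin k → ℝ) (W : Finset (Fin R)) (v : Fin k → ℝ) : Prop :=
  ∀ y, (∀ q ∈ W, c q ⬝ᵥ y = 0) → v ⬝ᵥ y = 0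

theorem InFlat.mono {R k : ℕ} {c : Fin R → Fin k → ℝ} {W W' : Finset (Fin R)} {v : Fin k → ℝ}
    (h : InFlat c W v) (hW : W ⊆ W') : InFlat c W' v :=
  fun y hy => h y fun q hq => hy q (hW hq)

/-- The `k - 1` vectors indexed by `S` span the whole hyperplane orthogonal to `x`. -/
theorem GeneralPosition.inFlat_of_orthogonal {R k : ℕ} {c : Fin R → Fin k → ℝ}
    (h : GeneralPosition c) (hk : k ≤ R) {S : Finset (Fin R)} (hS : S.card + 1 = k)
    {x v : Fin k → ℝ} (hx : ∀ r, c r ⬝ᵥ x = 0 ↔ r ∈ S) (hv : v ⬝ᵥ x = 0) : InFlat c S v := by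
  intro y hy
  obtain ⟨q, hq⟩ : ∃ q, q ∉ S := by
    by_contra! hall
    have : S = Finset.univ := Finset.eq_univ_of_forall hall
    rw [this, Finset.card_univ, Fintype.card_fin] at hS
    omega
  have hqx : c q ⬝ᵥ x ≠ 0 := fun h' => hq ((hx q).1 h')
  -- This combination is orthogonal to `c q` and to all vectors of `S`, that is to `k` vectors, so
  -- it is zero.
  set z := (c q ⬝ᵥ y) • x - (c q ⬝ᵥ x) • y with hz
  have hzq : c q ⬝ᵥ z = 0 := by
    rw [hz, dotProduct_sub, dotProduct_smul, dotProduct_smul, smul_eq_mul, smul_eq_mul]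
    ring
  have hzS : ∀ r ∈ S, c r ⬝ᵥ z = 0 := by
    intro r hr
    rw [hz, dotProduct_sub, dotProduct_smul, dotProduct_smul, (hx r).2 hr, hy r hr]
    simp
  have hz0 : z = 0 := by
    by_contra hz0
    have h₁ : insert q S ⊆ Finset.univ.filter fun r => c r ⬝ᵥ z = 0 := by
      intro r hr
      rcases Finset.mem_insert.1 hr with rfl | hr
      · simpa using hzq
      · simpa using hzS r hr
    have h₂ := Finset.card_le_card h₁
    rw [Finset.card_insert_of_notMem hq] at h₂
    have := h z hz0
    omega
  have hvz : v ⬝ᵥ z = 0 := by rw [hz0, dotProduct_zero]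
  rw [hz, dotProduct_sub, dotProduct_smul, dotProduct_smul, hv, smul_zero, zero_sub,
    neg_eq_zero, smul_eq_mul] at hvz
  exact (mul_eq_zero.1 hvz).resolve_left hqx

/-- At most `k` vectors are independent, so the two flats meet only in the flat of `W`. Dually, a
`y` orthogonal to `W` is made orthogonal to `c q'` by subtracting a multiple of some `z` orthogonal
to the flat of `insert q W` but not to `c q'`. -/
theorem GeneralPosition.inFlat_inter {R k : ℕ} {c : Fin R → Fin k → ℝ} (h : GeneralPosition c)
    (hk : k ≤ R) {W : Finset (Fin R)} (hW : W.card + 2 ≤ k) {q q' : Fin R} (hqq : q ≠ q')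
    (hq' : q' ∉ W) {v : Fin k → ℝ} (h₁ : InFlat c (insert q W) v)
    (h₂ : InFlat c (insert q' W) v) : InFlat c W v := by
  intro y hy
  obtain ⟨S, hS, hSu, hSc⟩ : ∃ S, insert q W ⊆ S ∧ S ⊆ Finset.univ.erase q' ∧
      S.card = k - 1 := by
    refine Finset.exists_subsuperset_card_eq ?_ ?_ ?_
    · intro r hr
      refine Finset.mem_erase.2 ⟨?_, Finset.mem_univ r⟩
      rintro rfl
      rcases Finset.mem_insert.1 hr with hr | hr
      · exact hqq hr.symm
      · exact hq' hr
    · have := Finset.card_insert_le q W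
      omega
    · rw [Finset.card_erase_of_mem (Finset.mem_univ _), Finset.card_univ, Fintype.card_fin]
      omega
  obtain ⟨z, -, hz⟩ := h.exists_orthogonal_iff (S := S) (by omega)
  have hzq' : c q' ⬝ᵥ z ≠ 0 := fun h' => by simpa using hSu ((hz q').1 h')
  set t := (c q' ⬝ᵥ y) / (c q' ⬝ᵥ z)
  have e₁ : v ⬝ᵥ z = 0 := h₁ z fun r hr => (hz r).2 (hS hr)
  have e₂ : v ⬝ᵥ (y - t • z) = 0 := by
    refine h₂ _ fun r hr => ?_
    rw [dotProduct_sub, dotProduct_smul, smul_eq_mul]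
    rcases Finset.mem_insert.1 hr with rfl | hr
    · rw [div_mul_cancel₀ _ hzq', sub_self]
    · rw [hy r hr, (hz r).2 (hS (Finset.mem_insert_of_mem hr)), mul_zero, sub_zero]
  rwa [dotProduct_sub, dotProduct_smul, e₁, smul_zero, sub_zero] at e₂

/-- Kruskal's permutation lemma for vectors in general position: if `c'` is in general position
and every vector orthogonal to all but few of the `c' r` is orthogonal to as many of the `c r`,
then the flats of `c'` contain enough of the vectors `c r`. -/
theorem GeneralPosition.card_le_card_inFlat {R k : ℕ} {c c' : Fin R → Fin k → ℝ}
    (h' : GeneralPosition c') (hk : k ≤ R)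
    (hw : ∀ x, k ≤ (Finset.univ.filter fun r => c' r ⬝ᵥ x = 0).card + 1 →
      k ≤ (Finset.univ.filter fun r => c r ⬝ᵥ x = 0).card + 1) (n : ℕ) :
    ∀ W : Finset (Fin R), W.card + 1 + n = k → ∃ Z : Finset (Fin R), W.card ≤ Z.card ∧
      ∀ r, r ∈ Z ↔ InFlat c' W (c r) := by
  classical
  induction n with
  | zero =>
    intro W hW
    refine ⟨Finset.univ.filter fun r => InFlat c' W (c r), ?_, by simp⟩
    obtain ⟨x, -, hx⟩ := h'.exists_orthogonal_iff (S := W) (by omega)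
    have h₁ : (Finset.univ.filter fun r => c' r ⬝ᵥ x = 0) = W := by
      ext r
      simp [hx]
    have h₂ := hw x (by rw [h₁]; omega)
    have h₃ : (Finset.univ.filter fun r => c r ⬝ᵥ x = 0) ⊆
        Finset.univ.filter fun r => InFlat c' W (c r) := by
      intro r hr
      simp only [Finset.mem_filter, Finset.mem_univ, true_and] at hr ⊢
      exact h'.inFlat_of_orthogonal hk (by omega) hx hr
    have := Finset.card_le_card h₃
    omega
  | succ n ih =>
    intro W hW
    set Z := Finset.univ.filter fun r => InFlat c' W (c r) with hZ
    refine ⟨Z, ?_, by simp [hZ]⟩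
    -- If the flat of `W` holds too few vectors, each flat of `insert q W` holds at least `W.card +
    -- 1 - Z.card` beyond `Z`. These surpluses are disjoint for the `R - W.card` choices of `q`, yet
    -- only `R - Z.card` vectors lie outside `Z`.
    by_contra! hlt
    choose! Y hY hY' using fun q (hq : q ∈ Wᶜ) => ih (insert q W) (by
      rw [Finset.card_insert_of_notMem (Finset.mem_compl.1 hq)]; omega)
    have hsub : ∀ q ∈ Wᶜ, Z ⊆ Y q := fun q hq r hr => by
      rw [hY' q hq]
      exact InFlat.mono (by simpa [hZ] using hr) (Finset.subset_insert _ _)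
    have hdisj : ∀ q ∈ Wᶜ, ∀ q' ∈ Wᶜ, q ≠ q' → Disjoint (Y q \ Z) (Y q' \ Z) := by
      intro q hq q' hq' hqq
      rw [Finset.disjoint_left]
      intro r hr hr'
      rw [Finset.mem_sdiff] at hr hr'
      refine hr.2 ?_
      rw [hZ, Finset.mem_filter]
      exact ⟨Finset.mem_univ _, h'.inFlat_inter hk (by omega) hqq (Finset.mem_compl.1 hq')
        ((hY' q hq r).1 hr.1) ((hY' q' hq' r).1 hr'.1)⟩
    have hsum : ∑ q ∈ Wᶜ, (Y q \ Z).card ≤ R - Z.card := by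
      rw [← Finset.card_biUnion hdisj]
      have : Wᶜ.biUnion (fun q => Y q \ Z) ⊆ Zᶜ := by
        intro r hr
        simp only [Finset.mem_biUnion, Finset.mem_sdiff] at hr
        obtain ⟨q, -, -, hr⟩ := hr
        exact Finset.mem_compl.2 hr
      simpa [Finset.card_compl] using Finset.card_le_card this
    have hge : Wᶜ.card * (W.card + 1 - Z.card) ≤ ∑ q ∈ Wᶜ, (Y q \ Z).card := by
      rw [← smul_eq_mul]
      refine Finset.card_nsmul_le_sum _ _ _ fun q hq => ?_
      rw [Finset.card_sdiff_of_subset (hsub q hq)]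
      have := hY q hq
      rw [Finset.card_insert_of_notMem (Finset.mem_compl.1 hq)] at this
      omega
    have hWc : Wᶜ.card = R - W.card := by simp [Finset.card_compl]
    rw [hWc] at hge
    obtain ⟨d, hd⟩ : ∃ d, W.card = Z.card + d + 1 := ⟨W.card - Z.card - 1, by omega⟩
    obtain ⟨t, ht⟩ : ∃ t, R = W.card + 2 + t := ⟨R - W.card - 2, by omega⟩
    have e₁ : R - W.card = t + 2 := by omega
    have e₂ : W.card + 1 - Z.card = d + 2 := by omega
    have e₃ : R - Z.card = d + 1 + 2 + t := by omega
    rw [e₁, e₂] at hge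
    rw [e₃] at hsum
    -- The count reads `(t + 2) * (d + 2) ≤ t + d + 3`, which is impossible.
    nlinarith [Nat.zero_le (t * d)]

theorem exists_smul_of_orthogonal_imp {k : ℕ} {a b : Fin k → ℝ} (hb : b ≠ 0)
    (h : ∀ y, a ⬝ᵥ y = 0 → b ⬝ᵥ y = 0) : ∃ γ : ℝ, γ ≠ 0 ∧ b = γ • a := by
  have ha : a ⬝ᵥ a ≠ 0 := by
    intro ha
    have ha' : a = 0 := dotProduct_self_eq_zero.1 ha
    exact hb (dotProduct_self_eq_zero.1 (h b (by rw [ha', zero_dotProduct])))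
  have hab : b = ((b ⬝ᵥ a) / (a ⬝ᵥ a)) • a := by
    rw [← sub_eq_zero]
    set z := b - ((b ⬝ᵥ a) / (a ⬝ᵥ a)) • a with hz
    have h₁ : a ⬝ᵥ z = 0 := by
      rw [hz, dotProduct_sub, dotProduct_smul, smul_eq_mul, div_mul_cancel₀ _ ha,
        dotProduct_comm, sub_self]
    have h₂ : z ⬝ᵥ z = 0 := by
      conv_lhs => rw [hz]
      rw [sub_dotProduct, smul_dotProduct, h₁, h z h₁, smul_zero, sub_zero]
    exact dotProduct_self_eq_zero.1 h₂
  refine ⟨_, fun h0 => hb ?_, hab⟩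
  rw [hab, h0, zero_smul]

/-! ### Generic factor matrices -/

/-- The hypotheses of the theorem, for a third factor with full row rank `k` and columns `c r`. -/
structure Generic {I J k R : ℕ} (m : ℕ) (A : Matrix (Fin I) (Fin R) ℝ)
    (B : Matrix (Fin J) (Fin R) ℝ) (c : Fin R → Fin k → ℝ) : Prop where
  two_le : 2 ≤ m
  two_le_k : 2 ≤ k
  add_eq : m + k = R + 2
  gp : GeneralPosition c
  minors : ∀ w : (Fin m ↪o Fin R) → ℝ, (∀ (e : Fin m → Fin I) (e' : Fin m → Fin J),
    ∑ U, w U * ((A.submatrix e U).det * (B.submatrix e' U).det) = 0) → w = 0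

theorem exists_orderEmbedding_range {m R : ℕ} {S : Finset (Fin R)} (hS : S.card = m) :
    ∃ U : Fin m ↪o Fin R, ∀ r, r ∈ Set.range U ↔ r ∈ S :=
  ⟨S.orderEmbOfFin hS, fun r => by rw [Finset.range_orderEmbOfFin]; rfl⟩

/-! ### Supports and ranks; minimality and uniqueness of the terms -/

namespace Generic

variable {I J k R m : ℕ} {A : Matrix (Fin I) (Fin R) ℝ} {B : Matrix (Fin J) (Fin R) ℝ}
  {c : Fin R → Fin k → ℝ}

/-- Otherwise the column of the Khatri–Rao product at `U` would be zero. -/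
theorem exists_minors (h : Generic m A B c) (U : Fin m ↪o Fin R) :
    ∃ (e : Fin m → Fin I) (e' : Fin m → Fin J),
      (A.submatrix e U).det ≠ 0 ∧ (B.submatrix e' U).det ≠ 0 := by
  classical
  by_contra! hall
  have := congrFun (h.minors (Pi.single U 1) fun e e' => ?_) U
  · simp at this
  · rw [Finset.sum_eq_single U]
    · by_cases he : (A.submatrix e U).det = 0
      · simp [he]
      · simp [hall e e' he]
    · intro U' _ hU
      simp [hU]
    · simp

/-- Low rank kills all `m × m` minors, so the vector of `m`-fold products of `d` lies in the kernel
of the Khatri–Rao product and vanishes. -/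
theorem card_support_lt (h : Generic m A B c) {d : Fin R → ℝ} (hd : (weighted A B d).rank < m) :
    (Finset.univ.filter fun r => d r ≠ 0).card < m := by
  by_contra! hle
  obtain ⟨S, hS, hSc⟩ := Finset.exists_subset_card_eq hle
  obtain ⟨U, hU⟩ := exists_orderEmbedding_range hSc
  have hw := congrFun (h.minors (fun U => ∏ i, d (U i)) fun e e' => ?_) U
  · simp only [Pi.zero_apply, Finset.prod_eq_zero_iff, Finset.mem_univ, true_and] at hw
    obtain ⟨i, hi⟩ := hw
    have := hS ((hU (U i)).1 ⟨i, rfl⟩)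
    simp [hi] at this
  · rw [← minor_weighted]
    by_contra hne
    exact absurd (le_rank_of_minor _ _ _ hne) (by omega)

/-- Pad the support `S` to exactly `m` indices. This adds at most `m - S.card` to the rank; if
`S.card > w`, the rank stays below `m`, contrary to `card_support_lt`. -/
theorem card_support_le (h : Generic m A B c) {d : Fin R → ℝ} {w : ℕ} (hw : w < m)
    (hd : (weighted A B d).rank ≤ w) : (Finset.univ.filter fun r => d r ≠ 0).card ≤ w := by
  by_contra! hlt
  set S := Finset.univ.filter fun r => d r ≠ 0 with hS
  have hSm : S.card < m := h.card_support_lt (hd.trans_lt hw)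
  have hR : m ≤ R := by have := h.add_eq; have := h.two_le_k; omega
  obtain ⟨T, hST, -, hT⟩ := Finset.exists_subsuperset_card_eq (Finset.subset_univ S) hSm.le
    (by simpa using hR)
  set δ : Fin R → ℝ := fun r => if r ∈ T \ S then 1 else 0 with hδ
  have hδs : (Finset.univ.filter fun r => δ r ≠ 0) = T \ S := by
    ext r
    simp [hδ]
  have hsum : (Finset.univ.filter fun r => (d + δ) r ≠ 0) = T := by
    ext r
    by_cases hr : r ∈ S
    · have hr' : d r ≠ 0 := by simpa [hS] using hr
      simp [hδ, hr, hr', hST hr]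
    · have hr' : d r = 0 := by simpa [hS] using hr
      simp [hδ, hr, hr']
  have hrank : (weighted A B (d + δ)).rank < m := by
    rw [weighted_add]
    have h₁ := rank_add_le (weighted A B d) (weighted A B δ)
    have h₂ := rank_weighted_le A B δ
    rw [hδs, Finset.card_sdiff_of_subset hST] at h₂
    omega
  have := h.card_support_lt hrank
  rw [hsum] at this
  omega

/-- The case of rank zero: the matrices `a_r b_rᵀ` are linearly independent. -/
theorem eq_zero_of_weighted (h : Generic m A B c) {d : Fin R → ℝ} (hd : weighted A B d = 0) :
    d = 0 := by
  have := h.card_support_le (d := d) (w := 0) (by have := h.two_le; omega) (by rw [hd]; simp)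
  rw [Nat.le_zero, Finset.card_eq_zero, Finset.filter_eq_empty_iff] at this
  funext r
  simpa using this (Finset.mem_univ r)

theorem exists_term_ne_zero (h : Generic m A B c) (r : Fin R) : ∃ i j, A i r * B j r ≠ 0 := by
  by_contra! hall
  have := congrFun (h.eq_zero_of_weighted (d := Pi.single r 1) ?_) r
  · simp at this
  · ext i j
    rw [weighted_apply, Finset.sum_eq_single r]
    · simp [hall]
    · intro q _ hq
      simp [hq]
    · simp

/-- The complement of `V` has `R - (m - 1) = k - 1` elements. -/
theorem exists_vertex (h : Generic m A B c) {V : Finset (Fin R)} (hV : V.card + 1 = m) :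
    ∃ b : Fin k → ℝ, ∀ r, c r ⬝ᵥ b ≠ 0 ↔ r ∈ V := by
  have := h.add_eq
  have := h.two_le
  have hle := Finset.card_le_univ V
  rw [Fintype.card_fin] at hle
  obtain ⟨b, -, hb⟩ := h.gp.exists_orthogonal_iff (S := Vᶜ) (by
    rw [Finset.card_compl, Fintype.card_fin]
    omega)
  exact ⟨b, fun r => by simp [hb]⟩

theorem ne_zero (h : Generic m A B c) (r : Fin R) : c r ≠ 0 := by
  intro hr
  have := h.two_le
  have := h.add_eq
  have := h.two_le_k
  obtain ⟨V, hV, -, hVc⟩ := Finset.exists_subsuperset_card_eq (s := {r}) (n := m - 1)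
    (Finset.subset_univ _) (by simp; omega) (by simp; omega)
  obtain ⟨b, hb⟩ := h.exists_vertex (V := V) (by omega)
  exact (hb r).2 (by simpa using hV) (by rw [hr, zero_dotProduct])

/-- Every `r` belongs to a set of `m` indices, with two distinguished vertices. -/
theorem exists_simplex (h : Generic m A B c) (r : Fin R) :
    ∃ (U : Fin m ↪o Fin R) (a : Fin m) (V V' : Finset (Fin R)), U a = r ∧
      V.card + 1 = m ∧ V'.card + 1 = m ∧ r ∈ V' ∧
      (∀ q, q ∈ V ↔ q ∈ Set.range U ∧ q ≠ r) ∧ ∀ q ∈ V', q ∈ Set.range U := by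
  have := h.two_le
  have := h.add_eq
  have := h.two_le_k
  obtain ⟨S, hS, -, hSc⟩ := Finset.exists_subsuperset_card_eq (s := {r}) (n := m)
    (Finset.subset_univ _) (by simp; omega) (by simp; omega)
  rw [Finset.singleton_subset_iff] at hS
  obtain ⟨U, hU⟩ := exists_orderEmbedding_range hSc
  obtain ⟨a, ha⟩ := (hU r).2 hS
  obtain ⟨r', hr', hne⟩ := Finset.exists_mem_ne (by omega) r (s := S)
  refine ⟨U, a, S.erase r, S.erase r', ha, ?_, ?_, ?_, ?_, ?_⟩
  · rw [Finset.card_erase_of_mem hS]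
    omega
  · rw [Finset.card_erase_of_mem hr']
    omega
  · exact Finset.mem_erase.2 ⟨hne.symm, hS⟩
  · intro q
    rw [Finset.mem_erase, hU, and_comm]
  · intro q hq
    exact (hU q).2 (Finset.mem_of_mem_erase hq)

/-- The support of the second decomposition bounds the rank of the common matrix, which in turn
bounds the support of the first. -/
theorem card_support_le_of_eq (h : Generic m A B c) {R' : ℕ} {A' : Matrix (Fin I) (Fin R') ℝ}
    {B' : Matrix (Fin J) (Fin R') ℝ} {c' : Fin R' → Fin k → ℝ}
    (hT : ∀ x, weighted A B (fun r => c r ⬝ᵥ x) = weighted A' B' (fun r => c' r ⬝ᵥ x))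
    {x : Fin k → ℝ} (hx : (Finset.univ.filter fun r => c' r ⬝ᵥ x ≠ 0).card < m) :
    (Finset.univ.filter fun r => c r ⬝ᵥ x ≠ 0).card ≤
      (Finset.univ.filter fun r => c' r ⬝ᵥ x ≠ 0).card :=
  h.card_support_le hx (by rw [hT]; exact rank_weighted_le _ _ _)

theorem _root_.CPD.card_zero_add_card_ne_zero {R k : ℕ} (c : Fin R → Fin k → ℝ) (x : Fin k → ℝ) :
    (Finset.univ.filter fun r => c r ⬝ᵥ x = 0).card +
      (Finset.univ.filter fun r => c r ⬝ᵥ x ≠ 0).card = R := by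
  rw [Finset.card_filter_add_card_filter_not]
  simp

/-- With `R' < R`, some `x ≠ 0` is orthogonal to `min R' (k - 1)` of the `c' r`. So few of the
others remain that at least `k` of the `c r` must be orthogonal to `x`, against general position. -/
theorem le_of_eq (h : Generic m A B c) {R' : ℕ} {A' : Matrix (Fin I) (Fin R') ℝ}
    {B' : Matrix (Fin J) (Fin R') ℝ} {c' : Fin R' → Fin k → ℝ}
    (hT : ∀ x, weighted A B (fun r => c r ⬝ᵥ x) = weighted A' B' (fun r => c' r ⬝ᵥ x)) :
    R ≤ R' := by
  by_contra! hlt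
  have := h.two_le
  have := h.add_eq
  have := h.two_le_k
  obtain ⟨S, -, hS⟩ := Finset.exists_subset_card_eq (s := (Finset.univ : Finset (Fin R')))
    (n := min R' (k - 1)) (by simp)
  obtain ⟨x, hx, hxS⟩ := exists_ne_zero_orthogonal c' S (by omega)
  have h₁ : S ⊆ Finset.univ.filter fun r => c' r ⬝ᵥ x = 0 := fun r hr => by
    simpa using hxS r hr
  have h₂ := Finset.card_le_card h₁
  have h₃ := card_zero_add_card_ne_zero c' x
  have h₄ := card_zero_add_card_ne_zero c x
  have h₅ := h.gp x hx
  have h₆ := h.card_support_le_of_eq hT (x := x) (by omega)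
  omega

/-- Kruskal's lemma for single-element flats matches each `c' r` with a proportional `c (σ r)`. Both
decompositions then have the same vertices, and `extract` applied to the same matrices returns the
matched rank-one terms. -/
theorem unique_up_to_third (h : Generic m A B c) {A' : Matrix (Fin I) (Fin R) ℝ}
    {B' : Matrix (Fin J) (Fin R) ℝ} {c' : Fin R → Fin k → ℝ}
    (hT : ∀ x, weighted A B (fun r => c r ⬝ᵥ x) = weighted A' B' (fun r => c' r ⬝ᵥ x)) :
    ∃ (σ : Equiv.Perm (Fin R)) (τ : Fin R → ℝ), ∀ r, τ r ≠ 0 ∧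
      ∀ i j, A' i r * B' j r = τ r * (A i (σ r) * B j (σ r)) := by
  have := h.two_le
  have := h.add_eq
  have hk := h.two_le_k
  have hw : ∀ x, k ≤ (Finset.univ.filter fun r => c' r ⬝ᵥ x = 0).card + 1 →
      (Finset.univ.filter fun r => c' r ⬝ᵥ x = 0).card ≤
        (Finset.univ.filter fun r => c r ⬝ᵥ x = 0).card := by
    intro x hx
    have h₃ := card_zero_add_card_ne_zero c' x
    have h₄ := card_zero_add_card_ne_zero c x
    have h₆ := h.card_support_le_of_eq hT (x := x) (by omega)
    omega
  -- A nonzero `x` orthogonal to `k` of the `c' r` would be orthogonal to at least `k` of the `c r`.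
  have hgp' : GeneralPosition c' := by
    intro x hx
    by_contra! hle
    have h₁ := hw x (by omega)
    have h₂ := h.gp x hx
    omega
  have hcol : ∀ r, ∃ q, InFlat c' {r} (c q) := by
    intro r
    obtain ⟨Z, hZ, hZ'⟩ := hgp'.card_le_card_inFlat (c := c) (by omega)
      (fun x hx => by have := hw x hx; omega) (k - 2) {r} (by rw [Finset.card_singleton]; omega)
    rw [Finset.card_singleton, Nat.one_le_iff_ne_zero, ← Nat.pos_iff_ne_zero,
      Finset.card_pos] at hZ
    obtain ⟨q, hq⟩ := hZ
    exact ⟨q, (hZ' q).1 hq⟩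
  choose σ hσ using hcol
  have hσi : Function.Injective σ := by
    intro r r' hrr
    by_contra hne
    have h₁ := hσ r
    have h₂ := hσ r'
    rw [← hrr] at h₂
    -- Two different lines meet only in zero; this uses `2 ≤ k`.
    have h₃ : InFlat c' ∅ (c (σ r)) := hgp'.inFlat_inter (by omega) (by simpa using hk) hne
      (by simp) (by simpa using h₁) (by simpa using h₂)
    exact h.ne_zero (σ r) (dotProduct_self_eq_zero.1 (h₃ _ (by simp)))
  let s : Equiv.Perm (Fin R) := Equiv.ofBijective σ (Finite.injective_iff_bijective.1 hσi)
  have hzero : ∀ r x, c' r ⬝ᵥ x = 0 ↔ c (s r) ⬝ᵥ x = 0 := by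
    intro r x
    obtain ⟨γ, hγ, hc⟩ := exists_smul_of_orthogonal_imp (h.ne_zero (s r))
      fun y hy => hσ r y (by simpa using hy)
    rw [hc, smul_dotProduct, smul_eq_mul, mul_eq_zero, or_iff_right hγ]
  suffices hτ : ∀ r, ∃ τ : ℝ, τ ≠ 0 ∧ ∀ i j, A' i r * B' j r = τ * (A i (s r) * B j (s r)) by
    choose τ hτ using hτ
    exact ⟨s, τ, hτ⟩
  intro r
  obtain ⟨U, a, V, V', ha, hV, hV', hrV', hVU, hVU'⟩ := h.exists_simplex (s r)
  obtain ⟨x₁, hx₁⟩ := h.exists_vertex hV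
  obtain ⟨x₀, hx₀⟩ := h.exists_vertex hV'
  obtain ⟨e, e', he, he'⟩ := h.exists_minors U
  have key := extract_weighted A B U.injective (d₀ := fun r => c r ⬝ᵥ x₀)
    (d₁ := fun r => c r ⬝ᵥ x₁) (fun q hq => by
      by_contra h0
      exact hq (hVU' q ((hx₀ q).1 h0))) (fun q hq => by
      by_contra h0
      exact hq ((hVU q).1 ((hx₁ q).1 h0)).1) a (by
      by_contra h0
      exact ((hVU _).1 ((hx₁ _).1 h0)).2 ha) e e'
  have key' := extract_weighted A' B' (U := fun q => s.symm (U q))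
    (s.symm.injective.comp U.injective) (d₀ := fun r => c' r ⬝ᵥ x₀)
    (d₁ := fun r => c' r ⬝ᵥ x₁) (fun q hq => by
      rw [hzero]
      by_contra h0
      obtain ⟨p, hp⟩ := hVU' _ ((hx₀ _).1 h0)
      exact hq ⟨p, by simp [hp]⟩) (fun q hq => by
      rw [hzero]
      by_contra h0
      obtain ⟨p, hp⟩ := ((hVU _).1 ((hx₁ _).1 h0)).1
      exact hq ⟨p, by simp [hp]⟩) a (by
      rw [hzero]
      by_contra h0
      exact ((hVU _).1 ((hx₁ _).1 h0)).2 (by simpa using ha)) e e'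
  have hra : s.symm (U a) = r := by rw [ha, Equiv.symm_apply_apply]
  simp only [ha] at key
  simp only [hra] at key'
  set κ := (A.submatrix e U).det * (B.submatrix e' U).det * (c (s r) ⬝ᵥ x₀) ^ 2 *
    ∏ b ∈ Finset.univ.erase a, c (U b) ⬝ᵥ x₁ with hκ
  set κ' := (A'.submatrix e fun q => s.symm (U q)).det *
    (B'.submatrix e' fun q => s.symm (U q)).det * (c' r ⬝ᵥ x₀) ^ 2 *
    ∏ b ∈ Finset.univ.erase a, c' (s.symm (U b)) ⬝ᵥ x₁ with hκ'
  have hκ0 : κ ≠ 0 := by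
    refine mul_ne_zero (mul_ne_zero (mul_ne_zero he he') (pow_ne_zero _ ((hx₀ _).2 hrV')))
      (Finset.prod_ne_zero_iff.2 fun b hb => (hx₁ _).2 ((hVU _).2 ⟨⟨b, rfl⟩, ?_⟩))
    rw [← ha]
    exact fun h0 => Finset.ne_of_mem_erase hb (U.injective h0)
  have heq : ∀ i j, κ * (A i (s r) * B j (s r)) = κ' * (A' i r * B' j r) := fun i j => by
    rw [← key, ← key', hT, hT]
  -- The minors of `A'` and `B'` are not controlled directly; `κ'` is nonzero because the extracted
  -- matrix is.
  have hκ'0 : κ' ≠ 0 := by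
    intro h0
    obtain ⟨i, j, hij⟩ := h.exists_term_ne_zero (s r)
    have := heq i j
    rw [h0, zero_mul] at this
    exact mul_ne_zero hκ0 hij this
  refine ⟨κ / κ', div_ne_zero hκ0 hκ'0, fun i j => ?_⟩
  rw [div_mul_eq_mul_div, heq, mul_div_cancel_left₀ _ hκ'0]

/-- The terms of the decomposition can be computed from the vertices. -/
theorem exists_extract (h : Generic m A B c) {σ : Type*} (β : σ → Fin k → ℝ)
    (hβ : ∀ b : Fin k → ℝ, (Finset.univ.filter fun r => c r ⬝ᵥ b ≠ 0).card + 1 = m →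
      ∃ s, ∃ t : ℝ, t ≠ 0 ∧ β s = t • b) (r : Fin R) :
    ∃ (s₀ s₁ : σ) (e : Fin m → Fin I) (e' : Fin m → Fin J) (κ : ℝ), κ ≠ 0 ∧ ∀ i j,
      extract (weighted A B fun r => c r ⬝ᵥ β s₀) (weighted A B fun r => c r ⬝ᵥ β s₁) e e' i j =
        κ * (A i r * B j r) := by
  obtain ⟨U, a, V, V', ha, hV, hV', hrV', hVU, hVU'⟩ := h.exists_simplex r
  have hvert : ∀ V : Finset (Fin R), V.card + 1 = m → ∃ s, ∀ r, c r ⬝ᵥ β s ≠ 0 ↔ r ∈ V := by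
    intro V hV
    obtain ⟨b, hb⟩ := h.exists_vertex hV
    obtain ⟨s, t, ht, hs⟩ := hβ b (by simpa [hb] using hV)
    refine ⟨s, fun r => ?_⟩
    rw [hs, dotProduct_smul, smul_eq_mul, mul_ne_zero_iff, ← hb]
    exact and_iff_right ht
  obtain ⟨s₁, hx₁⟩ := hvert V hV
  obtain ⟨s₀, hx₀⟩ := hvert V' hV'
  obtain ⟨e, e', he, he'⟩ := h.exists_minors U
  have key := extract_weighted A B U.injective (d₀ := fun r => c r ⬝ᵥ β s₀)
    (d₁ := fun r => c r ⬝ᵥ β s₁) (fun q hq => by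
      by_contra h0
      exact hq (hVU' q ((hx₀ q).1 h0))) (fun q hq => by
      by_contra h0
      exact hq ((hVU q).1 ((hx₁ q).1 h0)).1) a (by
      by_contra h0
      exact ((hVU _).1 ((hx₁ _).1 h0)).2 ha) e e'
  simp only [ha] at key
  refine ⟨s₀, s₁, e, e', _, ?_, key⟩
  refine mul_ne_zero (mul_ne_zero (mul_ne_zero he he') (pow_ne_zero _ ((hx₀ _).2 hrV')))
    (Finset.prod_ne_zero_iff.2 fun b hb => (hx₁ _).2 ((hVU _).2 ⟨⟨b, rfl⟩, ?_⟩))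
  rw [← ha]
  exact fun h0 => Finset.ne_of_mem_erase hb (U.injective h0)

end Generic

/-! ### Homogeneous polynomial functions -/

/-- The number of monomials of degree `d` in `k` variables. -/
abbrev numMonomials (k d : ℕ) : ℕ := Fintype.card (Sym (Fin k) d)

/-- The monomials of degree `d` in `k` variables. -/
def monomial {k d : ℕ} (s : Fin (numMonomials k d)) (x : Fin k → ℝ) : ℝ :=
  ((((Fintype.equivFin (Sym (Fin k) d)).symm s : Sym (Fin k) d) : Multiset (Fin k)).map x).prod

/-- Homogeneous polynomial functions of degree `d`. -/
def forms (k d : ℕ) : Submodule ℝ ((Fin k → ℝ) → ℝ) :=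
  Submodule.span ℝ (Set.range (monomial (k := k) (d := d)))

instance (k d : ℕ) : FiniteDimensional ℝ (forms k d) :=
  FiniteDimensional.span_of_finite ℝ (Set.finite_range _)

theorem numMonomials_eq (k d : ℕ) : numMonomials k d = (k + d - 1).choose d := by
  rw [numMonomials, Sym.card_sym_eq_multichoose, Fintype.card_fin, Nat.multichoose_eq]

/-- The upper bound suffices: where independence of the monomials is needed, it follows from
exhibiting enough products of linear forms. -/
theorem finrank_forms_le (k d : ℕ) : Module.finrank ℝ (forms k d) ≤ numMonomials k d := by
  refine (finrank_range_le_card _).trans ?_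
  simp

theorem monomial_mem_forms {k d : ℕ} (s : Fin (numMonomials k d)) :
    (monomial s : (Fin k → ℝ) → ℝ) ∈ forms k d :=
  Submodule.subset_span ⟨s, rfl⟩

theorem exists_monomial_eq {k d : ℕ} (s : Sym (Fin k) d) :
    ∃ t : Fin (numMonomials k d), ∀ x, monomial t x = ((s : Multiset (Fin k)).map x).prod :=
  ⟨Fintype.equivFin _ s, fun x => by simp [monomial]⟩

theorem exists_rat_monomial {k d : ℕ} (s : Fin (numMonomials k d)) (x : Fin k → ℚ) :
    ∃ q : ℚ, monomial s (fun i => (x i : ℝ)) = q := by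
  refine ⟨((((Fintype.equivFin (Sym (Fin k) d)).symm s : Sym (Fin k) d) :
    Multiset (Fin k)).map x).prod, ?_⟩
  rw [monomial, Rat.cast_multiset_prod, Multiset.map_map]
  rfl

theorem continuous_of_mem_forms {k d : ℕ} {f : (Fin k → ℝ) → ℝ} (hf : f ∈ forms k d) :
    Continuous f := by
  refine Submodule.span_induction (p := fun f _ => Continuous f) ?_ continuous_const
    (fun _ _ _ _ h₁ h₂ => h₁.add h₂) (fun a _ _ h => continuous_const.mul h) hf
  rintro _ ⟨s, rfl⟩
  unfold monomial
  exact continuous_multiset_prod _ fun i _ => continuous_apply i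

theorem coord_mul_mem_forms {k d : ℕ} {f : (Fin k → ℝ) → ℝ} (hf : f ∈ forms k d) (i : Fin k) :
    (fun x => x i * f x) ∈ forms k (d + 1) := by
  refine Submodule.span_induction (p := fun f _ => (fun x => x i * f x) ∈ forms k (d + 1))
    ?_ ?_ ?_ ?_ hf
  · rintro _ ⟨s, rfl⟩
    obtain ⟨t, ht⟩ := exists_monomial_eq (i ::ₛ ((Fintype.equivFin (Sym (Fin k) d)).symm s))
    convert monomial_mem_forms t using 1
    funext x
    rw [ht, Sym.coe_cons, Multiset.map_cons, Multiset.prod_cons]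
    simp [monomial]
  · convert (forms k (d + 1)).zero_mem using 1
    funext x
    exact mul_zero _
  · intro f g _ _ hf hg
    simpa [mul_add] using! (forms k (d + 1)).add_mem hf hg
  · intro a f _ hf
    simpa [mul_left_comm] using! (forms k (d + 1)).smul_mem a hf

theorem dot_mul_mem_forms {k d : ℕ} {f : (Fin k → ℝ) → ℝ} (hf : f ∈ forms k d)
    (v : Fin k → ℝ) : (fun x => (v ⬝ᵥ x) * f x) ∈ forms k (d + 1) := by
  have : (fun x => (v ⬝ᵥ x) * f x) = ∑ i, v i • fun x : Fin k → ℝ => x i * f x := by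
    funext x
    simp [dotProduct, Finset.sum_mul, mul_assoc]
  rw [this]
  exact Submodule.sum_mem _ fun i _ => Submodule.smul_mem _ _ (coord_mul_mem_forms hf i)

theorem prod_dot_mem_forms {k : ℕ} {ρ : Type*} (c : ρ → Fin k → ℝ) (S : Finset ρ) :
    (fun x => ∏ r ∈ S, c r ⬝ᵥ x) ∈ forms k S.card := by
  classical
  induction S using Finset.induction_on with
  | empty =>
    obtain ⟨t, ht⟩ := exists_monomial_eq (Sym.nil : Sym (Fin k) 0)
    rw [Finset.card_empty]
    convert monomial_mem_forms t using 1
    funext x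
    simp [ht]
  | insert r S hr ih =>
    rw [Finset.card_insert_of_notMem hr]
    simp only [Finset.prod_insert hr]
    exact dot_mul_mem_forms ih (c r)

theorem mem_forms_iff {k d : ℕ} {f : (Fin k → ℝ) → ℝ} :
    f ∈ forms k d ↔ ∃ w : Fin (numMonomials k d) → ℝ, ∀ x, f x = ∑ s, w s * monomial s x := by
  rw [forms, Submodule.mem_span_range_iff_exists_fun]
  refine exists_congr fun w => ⟨?_, fun h => ?_⟩
  · rintro rfl x
    simp
  · funext x
    simp [h]

/-- Rational points at which forms of degree `d` can be interpolated. -/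
theorem exists_unisolvent (k d : ℕ) {Y : Type*} [Fintype Y]
    (hY : numMonomials k d ≤ Fintype.card Y) :
    ∃ pt : Y → Fin k → ℚ, ∀ f ∈ forms k d, (∀ y, f (fun i => (pt y i : ℝ)) = 0) → f = 0 := by
  let g := Module.finBasis ℝ (forms k d)
  obtain ⟨q, hq⟩ := exists_det_ne_zero (fun (a : Fin k → ℚ) b => (g b : (Fin k → ℝ) → ℝ)
    fun i => (a i : ℝ)) (by
    intro w hw
    have h₀ : (∑ b, w b • g b : forms k d) = 0 := by
      rw [← Submodule.coe_eq_zero]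
      -- A form is continuous, so it vanishes if it vanishes at the rational points.
      have hd : DenseRange fun (a : Fin k → ℚ) (i : Fin k) => (a i : ℝ) :=
        DenseRange.piMap fun _ => Rat.denseRange_cast
      refine Continuous.ext_on hd (continuous_of_mem_forms (Submodule.coe_mem _))
        continuous_const ?_
      rintro _ ⟨a, rfl⟩
      simpa [mul_comm] using hw a
    funext b
    exact Fintype.linearIndependent_iff.1 g.linearIndependent w h₀ b)
  obtain ⟨ε⟩ : Nonempty (Fin (Module.finrank ℝ (forms k d)) ↪ Y) := by
    rw [Function.Embedding.nonempty_iff_card_le, Fintype.card_fin]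
    exact (finrank_forms_le k d).trans hY
  -- `Y` may exceed the dimension; the surplus indices get the point `0`, which does no harm.
  refine ⟨Function.extend ε q 0, fun f hf h => ?_⟩
  have hrep : f = ∑ b, g.repr ⟨f, hf⟩ b • (g b : (Fin k → ℝ) → ℝ) := by
    have := congrArg Subtype.val (g.sum_repr ⟨f, hf⟩)
    rw [Submodule.coe_sum] at this
    exact this.symm
  have hz : (fun b => g.repr ⟨f, hf⟩ b) = 0 := by
    refine Matrix.eq_zero_of_mulVec_eq_zero hq ?_
    funext a
    have := h (ε a)
    rw [ε.injective.extend_apply, hrep] at this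
    simpa [Matrix.mulVec, dotProduct, mul_comm] using this
  rw [hrep]
  simp [fun b => congrFun hz b]

/-- Every finite family of nonzero vectors misses the hyperplane of one of a fixed finite number
of rational vectors. -/
theorem exists_separating {k n : ℕ} {α : Type*} [Fintype α] (hα : Fintype.card α ≤ n)
    (w : α → Fin k → ℝ) (hw : ∀ a, w a ≠ 0) :
    ∃ t : Fin (n * k + 1), ∀ a, (fun i : Fin k => (t : ℝ) ^ (i : ℕ)) ⬝ᵥ w a ≠ 0 := by
  classical
  -- Along the moment curve each pairing is a nonzero polynomial in `t` with at most `k` roots, so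
  -- `n * k + 1` values of `t` cannot all fail.
  let p : α → Polynomial ℝ := fun a => ∑ i : Fin k, Polynomial.monomial (i : ℕ) (w a i)
  have hp : ∀ a, p a ≠ 0 := by
    intro a h0
    refine hw a (funext fun i => ?_)
    have := congrArg (fun q => Polynomial.coeff q (i : ℕ)) h0
    simpa [p, Polynomial.finsetSum_coeff, Polynomial.coeff_monomial, Fin.val_inj] using this
  have hdeg : ∀ a, (p a).roots.toFinset.card ≤ k := by
    intro a
    refine (Multiset.toFinset_card_le _).trans ((Polynomial.card_roots' _).trans ?_)
    refine Polynomial.natDegree_sum_le_of_forall_le _ _ fun i _ => ?_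
    exact (Polynomial.natDegree_monomial_le _).trans i.2.le
  by_contra! hall
  have h₁ : (Finset.univ.image fun t : Fin (n * k + 1) => (t : ℝ)) ⊆
      Finset.univ.biUnion fun a => (p a).roots.toFinset := by
    intro z hz
    obtain ⟨t, -, rfl⟩ := Finset.mem_image.1 hz
    obtain ⟨a, ha⟩ := hall t
    refine Finset.mem_biUnion.2 ⟨a, Finset.mem_univ a, ?_⟩
    rw [Multiset.mem_toFinset, Polynomial.mem_roots (hp a), Polynomial.IsRoot, ← ha]
    simp [p, Polynomial.eval_finsetSum, dotProduct, mul_comm]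
  have h₂ := (Finset.card_le_card h₁).trans (Finset.card_biUnion_le_card_mul _ _ k
    fun a _ => hdeg a)
  rw [Finset.card_image_of_injective _ (fun s t h => by simpa [Fin.ext_iff] using h),
    Finset.card_univ, Finset.card_univ, Fintype.card_fin] at h₂
  have := Nat.mul_le_mul_right k hα
  omega

/-! ### Eigenvectors of matrices with a known eigenbasis -/

section Eigen

variable {N : ℕ} {V : Type*} [Fintype V] {L : Matrix (Fin N) (Fin N) ℝ}
  {π : V → Fin N → ℝ} {δ : V → ℝ}

theorem exists_eigenbasis_matrix (hV : Fintype.card V = N) (hπ : LinearIndependent ℝ π)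
    (hL : ∀ a, L *ᵥ π a = δ a • π a) :
    ∃ (ε : Fin N ≃ V) (P : Matrix (Fin N) (Fin N) ℝ), IsUnit P.det ∧
      (∀ a b, P a b = π (ε b) a) ∧ L * P = P * diagonal fun b => δ (ε b) := by
  let ε : Fin N ≃ V := (finCongr hV.symm).trans (Fintype.equivFin V).symm
  refine ⟨ε, Matrix.of fun a b => π (ε b) a, ?_, fun _ _ => rfl, ?_⟩
  · rw [← Matrix.isUnit_iff_isUnit_det, ← Matrix.linearIndependent_cols_iff_isUnit]
    exact hπ.comp ε ε.injective
  · ext a b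
    have := congrFun (hL (ε b)) a
    rw [Matrix.mul_diagonal, Matrix.mul_apply]
    simpa [Matrix.mulVec, dotProduct, mul_comm] using this

/-- The traces are the power sums of the eigenvalues, so the Hankel matrix is a transposed
Vandermonde matrix times itself and its determinant is the discriminant. This tests for distinct
eigenvalues before a GEVD is requested. -/
theorem det_trace_pow_ne_zero_iff (hV : Fintype.card V = N) (hπ : LinearIndependent ℝ π)
    (hL : ∀ a, L *ᵥ π a = δ a • π a) :
    (Matrix.of fun i j : Fin N => (L ^ ((i : ℕ) + (j : ℕ))).trace).det ≠ 0 ↔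
      Function.Injective δ := by
  obtain ⟨ε, P, hP, -, hLP⟩ := exists_eigenbasis_matrix hV hπ hL
  have hpow : ∀ n : ℕ, L ^ n * P = P * diagonal fun b => δ (ε b) ^ n := by
    intro n
    induction n with
    | zero => simp
    | succ n ih =>
      rw [pow_succ, Matrix.mul_assoc, hLP, ← Matrix.mul_assoc, ih, Matrix.mul_assoc,
        Matrix.diagonal_mul_diagonal]
      simp [pow_succ]
  have htr : ∀ n : ℕ, (L ^ n).trace = ∑ b, δ (ε b) ^ n := by
    intro n
    have : L ^ n = P * (diagonal fun b => δ (ε b) ^ n) * P⁻¹ := by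
      rw [← hpow, Matrix.mul_assoc, Matrix.mul_nonsing_inv _ hP, Matrix.mul_one]
    rw [this, Matrix.trace_mul_comm, ← Matrix.mul_assoc, Matrix.nonsing_inv_mul _ hP,
      Matrix.one_mul, Matrix.trace_diagonal]
  have hvand : (Matrix.of fun i j : Fin N => (L ^ ((i : ℕ) + (j : ℕ))).trace) =
      (vandermonde fun b => δ (ε b))ᵀ * vandermonde fun b => δ (ε b) := by
    ext i j
    rw [Matrix.of_apply, htr]
    simp [Matrix.mul_apply, vandermonde_apply, pow_add]
  rw [hvand, Matrix.det_mul, Matrix.det_transpose, mul_self_ne_zero,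
    Matrix.det_vandermonde_ne_zero_iff]
  exact ⟨fun h => by simpa [Function.comp_def] using h.comp ε.symm.injective,
    fun h => h.comp ε.injective⟩

theorem simplePencil_of_eigenbasis (hV : Fintype.card V = N) (hπ : LinearIndependent ℝ π)
    (hL : ∀ a, L *ᵥ π a = δ a • π a) (hδ : Function.Injective δ) : SimplePencil L 1 := by
  obtain ⟨ε, P, hP, -, hLP⟩ := exists_eigenbasis_matrix hV hπ hL
  exact ⟨by simp, P, fun b => δ (ε b), ⟨hP, by rw [Matrix.one_mul, hLP]⟩, hδ.comp ε.injective⟩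

/-- In the basis `π` the matrix `L` is diagonal with distinct entries, so each column of `E` has at
most one nonzero coordinate there; nonsingularity makes every basis vector occur. -/
theorem exists_col_eq_smul_of_isGEVD (hV : Fintype.card V = N) (hπ : LinearIndependent ℝ π)
    (hL : ∀ a, L *ᵥ π a = δ a • π a) (hδ : Function.Injective δ)
    {E : Matrix (Fin N) (Fin N) ℝ} {d : Fin N → ℝ} (hE : IsGEVD L 1 E d) (a : V) :
    ∃ s, ∃ t : ℝ, E.col s = t • π a := by
  obtain ⟨ε, P, hP, hPπ, hLP⟩ := exists_eigenbasis_matrix hV hπ hL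
  obtain ⟨hEu, hEd⟩ := hE
  rw [Matrix.one_mul] at hEd
  set G := P⁻¹ * E with hG
  have hEG : E = P * G := by
    rw [hG, ← Matrix.mul_assoc, Matrix.mul_nonsing_inv _ hP, Matrix.one_mul]
  have hcomm : diagonal (fun b => δ (ε b)) * G = G * diagonal d := by
    have h₁ : P * (diagonal (fun b => δ (ε b)) * G) = P * (G * diagonal d) := by
      rw [← Matrix.mul_assoc, ← hLP, Matrix.mul_assoc, ← hEG, hEd, hEG, Matrix.mul_assoc]
    have h₂ := congrArg (fun M => P⁻¹ * M) h₁
    simpa [← Matrix.mul_assoc, Matrix.nonsing_inv_mul _ hP] using h₂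
  have hentry : ∀ b s, G b s ≠ 0 → δ (ε b) = d s := by
    intro b s hbs
    have := congrFun (congrFun hcomm b) s
    rw [Matrix.diagonal_mul, Matrix.mul_diagonal, mul_comm] at this
    exact mul_left_cancel₀ hbs this
  have hGdet : G.det ≠ 0 := by
    rw [hG, Matrix.det_mul]
    exact mul_ne_zero (Matrix.isUnit_nonsing_inv_det _ hP).ne_zero hEu.ne_zero
  obtain ⟨s, hs⟩ : ∃ s, G (ε.symm a) s ≠ 0 := by
    by_contra! h0
    exact hGdet (Matrix.det_eq_zero_of_row_eq_zero (ε.symm a) h0)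
  refine ⟨s, G (ε.symm a) s, funext fun i => ?_⟩
  rw [Matrix.col_apply, hEG, Matrix.mul_apply, Finset.sum_eq_single (ε.symm a)]
  · rw [hPπ, Equiv.apply_symm_apply, Pi.smul_apply, smul_eq_mul, mul_comm]
  · intro b _ hb
    have : G b s = 0 := by
      by_contra h0
      have := hδ ((hentry b s h0).trans (hentry _ s hs).symm)
      exact hb (ε.injective this)
    rw [this, mul_zero]
  · simp

end Eigen

/-- Reads off, without division, the eigenvalue of any matrix that has the `s`-th column of `E` as
an eigenvector, up to the common factor `E.det`. -/
theorem adjugate_mul_mul_apply_of_eigenvector {N : ℕ} {E M : Matrix (Fin N) (Fin N) ℝ}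
    {s : Fin N} {μ : ℝ} (h : M *ᵥ E.col s = μ • E.col s) :
    (E.adjugate * M * E) s s = E.det * μ := by
  have h₁ : ∀ i, (M * E) i s = μ * E i s := fun i => by
    have := congrFun h i
    simpa [Matrix.mulVec, Matrix.mul_apply, dotProduct] using this
  have h₂ : (E.adjugate * E) s s = E.det := by simp [Matrix.adjugate_mul]
  rw [Matrix.mul_assoc, Matrix.mul_apply]
  simp only [h₁]
  rw [← h₂, Matrix.mul_apply, Finset.sum_mul]
  exact Finset.sum_congr rfl fun i _ => by ring

/-! ### The star configuration of vertices -/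

/-- Sets of `d` out of `R` indices. -/
abbrev Facet (R d : ℕ) : Type := {V : Finset (Fin R) // V.card = d}

/-- The product of the linear forms `c r` over `r ∈ V`. -/
def facetForm {R k : ℕ} (c : Fin R → Fin k → ℝ) (V : Finset (Fin R)) (x : Fin k → ℝ) : ℝ :=
  ∏ r ∈ V, c r ⬝ᵥ x

/-- The product of the linear forms `c r` over the range of `U`. -/
def cellForm {R k m : ℕ} (c : Fin R → Fin k → ℝ) (U : Fin m ↪o Fin R) (x : Fin k → ℝ) : ℝ :=
  ∏ i, c (U i) ⬝ᵥ x

theorem facetForm_mem_forms {R k d : ℕ} (c : Fin R → Fin k → ℝ) (V : Facet R d) :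
    facetForm c V.1 ∈ forms k d := by
  have := prod_dot_mem_forms c V.1
  rw [V.2] at this
  exact this

theorem cellForm_mem_forms {R k m : ℕ} (c : Fin R → Fin k → ℝ) (U : Fin m ↪o Fin R) :
    cellForm c U ∈ forms k m := by
  have := prod_dot_mem_forms (fun i => c (U i)) Finset.univ
  rw [Finset.card_univ, Fintype.card_fin] at this
  exact this

/-- `b V` is orthogonal to exactly the vectors `c r` with `r ∉ V`. -/
def IsVertexFamily {R k d : ℕ} (c : Fin R → Fin k → ℝ) (b : Facet R d → Fin k → ℝ) : Prop :=
  ∀ V r, c r ⬝ᵥ b V ≠ 0 ↔ r ∈ V.1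

section Vertices

variable {R k d : ℕ} {c : Fin R → Fin k → ℝ} {b : Facet R d → Fin k → ℝ}

/-- A nonzero value means `V ⊆ V'`, hence equality by cardinality. The facet forms are thus a
Lagrange system for the vertices. -/
theorem IsVertexFamily.facetForm_ne_zero_iff (hb : IsVertexFamily c b) (V V' : Facet R d) :
    facetForm c V.1 (b V') ≠ 0 ↔ V = V' := by
  rw [facetForm, Finset.prod_ne_zero_iff]
  constructor
  · intro h
    exact Subtype.ext (Finset.eq_of_subset_of_card_le (fun r hr => (hb V' r).1 (h r hr))
      (by rw [V.2, V'.2]))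
  · rintro rfl r hr
    exact (hb V r).2 hr

theorem IsVertexFamily.facetForm_eq_zero (hb : IsVertexFamily c b) {V V' : Facet R d}
    (h : V ≠ V') : facetForm c V.1 (b V') = 0 := by
  by_contra h0
  exact h ((hb.facetForm_ne_zero_iff V V').1 h0)

theorem IsVertexFamily.cellForm_eq_zero (hb : IsVertexFamily c b) (U : Fin (d + 1) ↪o Fin R)
    (V : Facet R d) : cellForm c U (b V) = 0 := by
  by_contra h
  rw [← ne_eq, cellForm, Finset.prod_ne_zero_iff] at h
  have h₁ : Finset.univ.map U.toEmbedding ⊆ V.1 := by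
    intro r hr
    obtain ⟨i, -, rfl⟩ := Finset.mem_map.1 hr
    exact (hb V _).1 (h i (Finset.mem_univ i))
  have := Finset.card_le_card h₁
  rw [Finset.card_map, Finset.card_univ, Fintype.card_fin, V.2] at this
  omega

theorem IsVertexFamily.eq_zero_of_sum (hb : IsVertexFamily c b) {w : Facet R d → ℝ}
    (h : ∀ V', ∑ V, w V * facetForm c V.1 (b V') = 0) : w = 0 := by
  funext V
  have := h V
  rw [Finset.sum_eq_single V (fun V' _ hV' => by rw [hb.facetForm_eq_zero hV', mul_zero])
    (by simp)] at this
  exact (mul_eq_zero.1 this).resolve_right ((hb.facetForm_ne_zero_iff V V).2 rfl)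

theorem card_facet (R d : ℕ) : Fintype.card (Facet R d) = R.choose d := by
  rw [Fintype.card_finset_len, Fintype.card_fin]

theorem card_orderEmbedding (R m : ℕ) : Fintype.card (Fin m ↪o Fin R) = R.choose m := by
  rw [Fintype.card_congr (Set.powersetCard.ofFinEmbEquiv (n := m) (I := Fin R)),
    ← Nat.card_eq_fintype_card, Set.powersetCard.card, Nat.card_eq_fintype_card,
    Fintype.card_fin]

theorem span_eq_of_linearIndependent {E ι : Type*} [AddCommGroup E] [Module ℝ E] [Fintype ι]
    {F : Submodule ℝ E} [FiniteDimensional ℝ F] {g : ι → E} (hg : LinearIndependent ℝ g)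
    (hF : ∀ i, g i ∈ F) (hc : Module.finrank ℝ F ≤ Fintype.card ι) :
    Submodule.span ℝ (Set.range g) = F := by
  refine Submodule.eq_of_le_of_finrank_le (Submodule.span_le.2 ?_) ?_
  · rintro _ ⟨i, rfl⟩
    exact hF i
  · rwa [finrank_span_eq_card hg]

end Vertices

/-! ### Bases of the forms of degree `d` and `d + 1` adapted to the vertices -/

namespace Generic

variable {I J k R d : ℕ} {A : Matrix (Fin I) (Fin R) ℝ} {B : Matrix (Fin J) (Fin R) ℝ}
  {c : Fin R → Fin k → ℝ} {b : Facet R d → Fin k → ℝ}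

theorem exists_isVertexFamily (h : Generic (d + 1) A B c) :
    ∃ b : Facet R d → Fin k → ℝ, IsVertexFamily c b := by
  choose b hb using fun V : Facet R d => h.exists_vertex (V := V.1) (by rw [V.2])
  exact ⟨b, hb⟩

theorem numMonomials_eq_card (h : Generic (d + 1) A B c) :
    numMonomials k d = Fintype.card (Facet R d) := by
  have := h.add_eq
  have := h.two_le_k
  rw [card_facet, numMonomials_eq]
  congr 1
  omega

/-- Since `k + d = R + 1`, this is Pascal's rule. It makes the interpolation matrix square. -/
theorem numMonomials_succ (h : Generic (d + 1) A B c) :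
    numMonomials k (d + 1) =
      Fintype.card (Fin (numMonomials k d) ⊕ (Fin (d + 1) ↪o Fin R)) := by
  have := h.add_eq
  have := h.two_le_k
  rw [Fintype.card_sum, Fintype.card_fin, h.numMonomials_eq_card, card_facet,
    card_orderEmbedding, numMonomials_eq, ← Nat.choose_succ_succ]
  congr 1
  omega

theorem vertex_ne_zero (h : Generic (d + 1) A B c) (hb : IsVertexFamily c b) (V : Facet R d) :
    b V ≠ 0 := by
  have := h.two_le
  obtain ⟨r, hr⟩ : V.1.Nonempty := Finset.card_pos.1 (by rw [V.2]; omega)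
  intro h0
  exact (hb V r).2 hr (by rw [h0, dotProduct_zero])

/-- On the line through two vertices whose index sets lie in the range of `U`, all forms outside
that range vanish, and only finitely many parameters annihilate one of the others. -/
theorem exists_cell_point (h : Generic (d + 1) A B c) (hb : IsVertexFamily c b)
    (U : Fin (d + 1) ↪o Fin R) :
    ∃ x, cellForm c U x ≠ 0 ∧ ∀ U', U' ≠ U → cellForm c U' x = 0 := by
  have hd : 2 ≤ d + 1 := h.two_le
  have hSc : (Finset.univ.map U.toEmbedding).card = d + 1 := by simp
  set S := Finset.univ.map U.toEmbedding with hS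
  obtain ⟨r₁, hr₁⟩ : S.Nonempty := Finset.card_pos.1 (by omega)
  obtain ⟨r₂, hr₂, hne⟩ := Finset.exists_mem_ne (by omega) r₁ (s := S)
  let V₁ : Facet R d := ⟨S.erase r₁, by rw [Finset.card_erase_of_mem hr₁]; omega⟩
  let V₂ : Facet R d := ⟨S.erase r₂, by rw [Finset.card_erase_of_mem hr₂]; omega⟩
  obtain ⟨t, ht⟩ := Infinite.exists_notMem_finset
    (Finset.univ.image fun r => -(c r ⬝ᵥ b V₁) / (c r ⬝ᵥ b V₂))
  have hx : ∀ r, c r ⬝ᵥ (b V₁ + t • b V₂) ≠ 0 ↔ r ∈ S := by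
    intro r
    rw [dotProduct_add, dotProduct_smul, smul_eq_mul]
    constructor
    · intro h0
      by_contra hr
      have e₁ : c r ⬝ᵥ b V₁ = 0 := by
        by_contra h₁
        exact hr (Finset.mem_of_mem_erase ((hb V₁ r).1 h₁))
      have e₂ : c r ⬝ᵥ b V₂ = 0 := by
        by_contra h₁
        exact hr (Finset.mem_of_mem_erase ((hb V₂ r).1 h₁))
      simp [e₁, e₂] at h0
    · intro hr h0
      by_cases h₂ : c r ⬝ᵥ b V₂ = 0
      · rw [h₂, mul_zero, add_zero] at h0
        have h₃ : r ∉ V₂.1 := fun h' => (hb V₂ r).2 h' h₂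
        have h₄ : r ∉ V₁.1 := fun h' => (hb V₁ r).2 h' h0
        simp only [V₁, V₂, Finset.mem_erase, hr, and_true, not_not] at h₃ h₄
        exact hne (h₃.symm.trans h₄)
      · refine ht (Finset.mem_image.2 ⟨r, Finset.mem_univ r, ?_⟩)
        rw [div_eq_iff h₂]
        linarith
  refine ⟨_, Finset.prod_ne_zero_iff.2 fun i _ => (hx _).2 (by simp [hS]), fun U' hU' => ?_⟩
  by_contra h0
  rw [← ne_eq, cellForm, Finset.prod_ne_zero_iff] at h0
  have hsub : Finset.univ.map U'.toEmbedding ⊆ S := by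
    intro r hr
    obtain ⟨i, -, rfl⟩ := Finset.mem_map.1 hr
    exact (hx _).1 (h0 i (Finset.mem_univ i))
  have heq := Finset.eq_of_subset_of_card_le hsub (by simp [hS])
  refine hU' (OrderEmbedding.range_inj.1 ?_)
  have := congrArg (fun s : Finset (Fin R) => (s : Set (Fin R))) heq
  simpa [hS] using this

theorem cell_eq_zero_of_sum (h : Generic (d + 1) A B c) (hb : IsVertexFamily c b)
    {w : (Fin (d + 1) ↪o Fin R) → ℝ} (hw : ∀ x, ∑ U, w U * cellForm c U x = 0) : w = 0 := by
  funext U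
  obtain ⟨x, hx, hx'⟩ := h.exists_cell_point hb U
  have := hw x
  rw [Finset.sum_eq_single U (fun U' _ hU' => by rw [hx' U' hU', mul_zero]) (by simp)] at this
  exact (mul_eq_zero.1 this).resolve_right hx

/-- The facet forms are independent by the Lagrange property, and there are as many of them as
monomials of degree `d`. -/
theorem exists_facet_sum (h : Generic (d + 1) A B c) (hb : IsVertexFamily c b)
    {f : (Fin k → ℝ) → ℝ} (hf : f ∈ forms k d) :
    ∃ w : Facet R d → ℝ, ∀ x, f x = ∑ V, w V * facetForm c V.1 x := by
  have hli : LinearIndependent ℝ fun V : Facet R d => facetForm c V.1 := by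
    refine Fintype.linearIndependent_iff.2 fun w hw V => ?_
    exact congrFun (hb.eq_zero_of_sum fun V' => by simpa using congrFun hw (b V')) V
  rw [← span_eq_of_linearIndependent hli (fun V => facetForm_mem_forms c V)
    ((finrank_forms_le k d).trans h.numMonomials_eq_card.le),
    Submodule.mem_span_range_iff_exists_fun] at hf
  obtain ⟨w, rfl⟩ := hf
  exact ⟨w, fun x => by simp⟩

theorem monomial_eq_zero_of_sum (h : Generic (d + 1) A B c) (hb : IsVertexFamily c b)
    {w : Fin (numMonomials k d) → ℝ} (hw : ∀ V, ∑ s, w s * monomial s (b V) = 0) : w = 0 := by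
  have hspan : Module.finrank ℝ (forms k d) = numMonomials k d := by
    refine le_antisymm (finrank_forms_le k d) ?_
    rw [h.numMonomials_eq_card]
    have hli : LinearIndependent ℝ fun V : Facet R d =>
        (⟨facetForm c V.1, facetForm_mem_forms c V⟩ : forms k d) := by
      refine Fintype.linearIndependent_iff.2 fun w hw V => ?_
      refine congrFun (hb.eq_zero_of_sum fun V' => ?_) V
      have := congrArg Subtype.val hw
      rw [Submodule.coe_sum] at this
      simpa using congrFun this (b V')
    exact hli.fintype_card_le_finrank
  have hli : LinearIndependent ℝ (monomial (k := k) (d := d)) := by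
    rw [linearIndependent_iff_card_eq_finrank_span, Fintype.card_fin]
    exact hspan.symm
  obtain ⟨w', hw'⟩ := h.exists_facet_sum hb (mem_forms_iff.2 ⟨w, fun x => rfl⟩)
  have hw'0 : w' = 0 := hb.eq_zero_of_sum fun V => by rw [← hw', hw]
  funext s
  refine Fintype.linearIndependent_iff.1 hli w (funext fun x => ?_) s
  have := hw' x
  simp only [hw'0, Pi.zero_apply, zero_mul, Finset.sum_const_zero] at this
  simpa using this

theorem exists_separating (h : Generic (d + 1) A B c) (hb : IsVertexFamily c b) {n : ℕ}
    (hn : numMonomials k d ≤ n) :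
    ∃ t : Fin (n * k + 1), ∀ V, (fun i : Fin k => (t : ℝ) ^ (i : ℕ)) ⬝ᵥ b V ≠ 0 :=
  CPD.exists_separating (by rw [← h.numMonomials_eq_card]; exact hn) b (h.vertex_ne_zero hb)

/-- Forms that vanish at the vertices are combinations of the `cellForm`s. -/
theorem exists_cell_sum (h : Generic (d + 1) A B c) (hb : IsVertexFamily c b)
    {f : (Fin k → ℝ) → ℝ} (hf : f ∈ forms k (d + 1)) (hfb : ∀ V, f (b V) = 0) :
    ∃ w : (Fin (d + 1) ↪o Fin R) → ℝ, ∀ x, f x = ∑ U, w U * cellForm c U x := by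
  obtain ⟨t, hv⟩ := h.exists_separating hb le_rfl
  set v := fun i : Fin k => (t : ℝ) ^ (i : ℕ)
  -- Facet forms times `v · x` complete the cell forms to a basis in degree `d + 1`. Evaluation at
  -- the vertices, where the cell forms vanish, isolates the first kind.
  let g : Facet R d ⊕ (Fin (d + 1) ↪o Fin R) → (Fin k → ℝ) → ℝ :=
    Sum.elim (fun V x => (v ⬝ᵥ x) * facetForm c V.1 x) (cellForm c)
  have hsum : ∀ (w : Facet R d ⊕ (Fin (d + 1) ↪o Fin R) → ℝ) (x : Fin k → ℝ),
      (∑ i, w i • g i) x = (v ⬝ᵥ x) * (∑ V, w (Sum.inl V) * facetForm c V.1 x) +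
        ∑ U, w (Sum.inr U) * cellForm c U x := by
    intro w x
    simp [g, Fintype.sum_sum_type, Finset.mul_sum, mul_left_comm]
  have hvert : ∀ w : Facet R d ⊕ (Fin (d + 1) ↪o Fin R) → ℝ,
      (∀ V, (∑ i, w i • g i) (b V) = 0) → ∀ V, w (Sum.inl V) = 0 := by
    intro w hw V
    refine congrFun (hb.eq_zero_of_sum (w := fun V => w (Sum.inl V)) fun V' => ?_) V
    have := hw V'
    simp only [hsum, hb.cellForm_eq_zero, mul_zero, Finset.sum_const_zero, add_zero] at this
    exact (mul_eq_zero.1 this).resolve_left (hv V')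
  have hli : LinearIndependent ℝ g := by
    refine Fintype.linearIndependent_iff.2 fun w hw => ?_
    have h₁ := hvert w fun V => by rw [hw, Pi.zero_apply]
    have h₂ : (fun U => w (Sum.inr U)) = 0 := h.cell_eq_zero_of_sum hb fun x => by
      have := hsum w x
      rw [hw] at this
      simpa [h₁] using this.symm
    rintro (V | U)
    · exact h₁ V
    · exact congrFun h₂ U
  have hmem : ∀ i, g i ∈ forms k (d + 1) := by
    rintro (V | U)
    · exact dot_mul_mem_forms (facetForm_mem_forms c V) v
    · exact cellForm_mem_forms c U
  rw [← span_eq_of_linearIndependent hli hmem ((finrank_forms_le k _).trans (by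
    rw [h.numMonomials_succ, Fintype.card_sum, Fintype.card_sum, Fintype.card_fin,
      h.numMonomials_eq_card])), Submodule.mem_span_range_iff_exists_fun] at hf
  obtain ⟨w, rfl⟩ := hf
  have h₁ := hvert w hfb
  exact ⟨fun U => w (Sum.inr U), fun x => by simp [hsum, h₁]⟩

end Generic

/-! ### The pencil -/

/-- The linear combination of slices with coefficients `x`. -/
def slice {I J k : ℕ} (S : Fin k → Matrix (Fin I) (Fin J) ℝ) (x : Fin k → ℝ) :
    Matrix (Fin I) (Fin J) ℝ :=
  Matrix.of fun i j => ∑ l, S l i j * x l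

/-- Positions of `U`-indexed families of `m × m` minors. -/
abbrev MinorChoice (I J R m : ℕ) : Type :=
  (Fin m ↪o Fin R) → (Fin m → Fin I) × (Fin m → Fin J)

/-- Row and column indices of the interpolation matrix. -/
abbrev InterpIndex (R k d : ℕ) : Type := Fin (numMonomials k d) ⊕ (Fin (d + 1) ↪o Fin R)

/-- The values, at the points `pt`, of `v · x` times the monomials of degree `d`, and of some
minors of size `d + 1` of the slices. -/
def interp {I J k R d : ℕ} (pt : InterpIndex R k d → Fin k → ℝ) (v : Fin k → ℝ)
    (C : MinorChoice I J R (d + 1)) (S : Fin k → Matrix (Fin I) (Fin J) ℝ) :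
    Matrix (InterpIndex R k d) (InterpIndex R k d) ℝ :=
  Matrix.of fun y => Sum.elim (fun s => (v ⬝ᵥ pt y) * monomial s (pt y))
    fun U => ((slice S (pt y)).submatrix (C U).1 (C U).2).det

/-- The values of the `i`-th coordinate times the monomials of degree `d`. -/
def coordMat {k R d : ℕ} (pt : InterpIndex R k d → Fin k → ℝ) (i : Fin k) :
    Matrix (InterpIndex R k d) (Fin (numMonomials k d)) ℝ :=
  Matrix.of fun y s => pt y i * monomial s (pt y)

/-- Multiplication by the `i`-th coordinate modulo the minors, divided by `v · x`. -/
def mulMat {I J k R d : ℕ} (pt : InterpIndex R k d → Fin k → ℝ) (v : Fin k → ℝ)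
    (C : MinorChoice I J R (d + 1)) (S : Fin k → Matrix (Fin I) (Fin J) ℝ) (i : Fin k) :
    Matrix (Fin (numMonomials k d)) (Fin (numMonomials k d)) ℝ :=
  ((interp pt v C S).adjugate * coordMat pt i).submatrix Sum.inl id

/-- Forms of degree `d + 1` are determined by their values at the points `pt`. -/
def Unisolvent {R k d : ℕ} (pt : InterpIndex R k d → Fin k → ℝ) : Prop :=
  ∀ f ∈ forms k (d + 1), (∀ y, f (pt y) = 0) → f = 0

theorem interp_mulVec {I J k R d : ℕ} (pt : InterpIndex R k d → Fin k → ℝ) (v : Fin k → ℝ)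
    (C : MinorChoice I J R (d + 1)) (S : Fin k → Matrix (Fin I) (Fin J) ℝ)
    (w : InterpIndex R k d → ℝ) (y : InterpIndex R k d) :
    (interp pt v C S *ᵥ w) y =
      (v ⬝ᵥ pt y) * (∑ s, w (Sum.inl s) * monomial s (pt y)) +
        ∑ U, w (Sum.inr U) * ((slice S (pt y)).submatrix (C U).1 (C U).2).det := by
  simp only [Matrix.mulVec, dotProduct, Fintype.sum_sum_type, interp, Matrix.of_apply,
    Sum.elim_inl, Sum.elim_inr, Finset.mul_sum]
  congr 1
  · exact Finset.sum_congr rfl fun _ _ => by ring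
  · exact Finset.sum_congr rfl fun _ _ => by ring

/-! ### Multiplication modulo the minors and its eigenvectors -/

namespace Generic

variable {I J k R d : ℕ} {A : Matrix (Fin I) (Fin R) ℝ} {B : Matrix (Fin J) (Fin R) ℝ}
  {c : Fin R → Fin k → ℝ} {b : Facet R d → Fin k → ℝ} {pt : InterpIndex R k d → Fin k → ℝ}
  {v : Fin k → ℝ} {C : MinorChoice I J R (d + 1)} {S : Fin k → Matrix (Fin I) (Fin J) ℝ}

/-- Coefficients of the chosen minors in terms of the `cellForm`s. -/
def minorMat (A : Matrix (Fin I) (Fin R) ℝ) (B : Matrix (Fin J) (Fin R) ℝ)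
    (C : MinorChoice I J R (d + 1)) :
    Matrix (Fin (d + 1) ↪o Fin R) (Fin (d + 1) ↪o Fin R) ℝ :=
  Matrix.of fun U U' => (A.submatrix (C U).1 U').det * (B.submatrix (C U).2 U').det

theorem sum_minors_eq (hS : ∀ x, slice S x = weighted A B fun r => c r ⬝ᵥ x)
    (w : (Fin (d + 1) ↪o Fin R) → ℝ) (x : Fin k → ℝ) :
    ∑ U, w U * ((slice S x).submatrix (C U).1 (C U).2).det =
      ∑ U, (w ᵥ* minorMat A B C) U * cellForm c U x := by
  simp only [hS, minor_weighted, Matrix.vecMul, dotProduct, minorMat, Matrix.of_apply,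
    Finset.mul_sum, Finset.sum_mul, cellForm]
  rw [Finset.sum_comm]
  exact Finset.sum_congr rfl fun _ _ => Finset.sum_congr rfl fun _ _ => by ring

theorem sum_minors_mem_forms (hS : ∀ x, slice S x = weighted A B fun r => c r ⬝ᵥ x)
    (w : (Fin (d + 1) ↪o Fin R) → ℝ) :
    (fun x => ∑ U, w U * ((slice S x).submatrix (C U).1 (C U).2).det) ∈ forms k (d + 1) := by
  simp only [sum_minors_eq hS]
  convert Submodule.sum_mem (forms k (d + 1)) (t := Finset.univ) fun U _ =>
    Submodule.smul_mem _ ((w ᵥ* minorMat A B C) U) (cellForm_mem_forms c U) using 1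
  funext x
  simp

/-- Choose minors whose coefficient rows form a nonsingular matrix. A kernel vector of `interp`
gives a form of degree `d + 1` that vanishes at `pt`, hence identically; evaluation at the vertices
kills its multiple of `v · x`, and independence of the cell forms kills the rest. -/
theorem exists_minorChoice (h : Generic (d + 1) A B c) (hb : IsVertexFamily c b)
    (hpt : Unisolvent pt) (hS : ∀ x, slice S x = weighted A B fun r => c r ⬝ᵥ x) :
    ∃ C : MinorChoice I J R (d + 1), ∀ v, (∀ V, v ⬝ᵥ b V ≠ 0) → (interp pt v C S).det ≠ 0 := by
  obtain ⟨C, hC⟩ := exists_det_ne_zero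
    (fun (e : (Fin (d + 1) → Fin I) × (Fin (d + 1) → Fin J)) (U : Fin (d + 1) ↪o Fin R) =>
      (A.submatrix e.1 U).det * (B.submatrix e.2 U).det) fun w hw => h.minors w fun e e' => by
        rw [← hw (e, e')]
        exact Finset.sum_congr rfl fun _ _ => mul_comm _ _
  refine ⟨C, fun v hv hdet => ?_⟩
  obtain ⟨w, hw0, hw⟩ := Matrix.exists_mulVec_eq_zero_iff.2 hdet
  have hfmem := (forms k (d + 1)).add_mem
    (dot_mul_mem_forms (mem_forms_iff.2 ⟨fun s => w (Sum.inl s), fun x => rfl⟩) v)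
    (sum_minors_mem_forms (C := C) hS fun U => w (Sum.inr U))
  have hf := hpt _ hfmem fun y => by
    have := congrFun hw y
    rwa [interp_mulVec] at this
  have h₁ : (fun s => w (Sum.inl s)) = 0 := by
    refine h.monomial_eq_zero_of_sum hb fun V => ?_
    have := congrFun hf (b V)
    simp only [Pi.add_apply, sum_minors_eq hS, hb.cellForm_eq_zero, mul_zero,
      Finset.sum_const_zero, add_zero, Pi.zero_apply] at this
    exact (mul_eq_zero.1 this).resolve_left (hv V)
  have h₂ : (fun U => w (Sum.inr U)) = 0 := by
    refine Matrix.eq_zero_of_vecMul_eq_zero hC (h.cell_eq_zero_of_sum hb fun x => ?_)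
    have := congrFun hf x
    simp only [Pi.add_apply, fun s => congrFun h₁ s, Pi.zero_apply, zero_mul,
      Finset.sum_const_zero, mul_zero, zero_add, sum_minors_eq hS] at this
    exact this
  refine hw0 (funext ?_)
  rintro (s | U)
  · exact congrFun h₁ s
  · exact congrFun h₂ U

/-- The forms that vanish at the vertices are simultaneous eigenvectors. -/
theorem exists_eigenvectors (h : Generic (d + 1) A B c) (hb : IsVertexFamily c b)
    (hS : ∀ x, slice S x = weighted A B fun r => c r ⬝ᵥ x) (hQ : (interp pt v C S).det ≠ 0) :
    ∃ π : Facet R d → Fin (numMonomials k d) → ℝ, LinearIndependent ℝ π ∧ ∀ V,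
      v ⬝ᵥ b V ≠ 0 ∧ ∀ i, mulMat pt v C S i *ᵥ π V =
        ((interp pt v C S).det * (b V i / (v ⬝ᵥ b V))) • π V := by
  choose π hπ using fun V : Facet R d => mem_forms_iff.1 (facetForm_mem_forms c V)
  -- Nonsingularity of `interp` is all the procedure can test; it already implies that the minors
  -- and `v` were well chosen.
  have hG : (minorMat A B C).det ≠ 0 := by
    intro h0
    obtain ⟨w, hw0, hw⟩ := Matrix.exists_vecMul_eq_zero_iff.2 h0
    have := Matrix.eq_zero_of_mulVec_eq_zero hQ (v := Sum.elim 0 w) (by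
      funext y
      simp [interp_mulVec, sum_minors_eq hS, hw])
    exact hw0 (funext fun U => congrFun this (Sum.inr U))
  have hspan : ∀ f ∈ forms k (d + 1), (∀ V, f (b V) = 0) → ∃ γ : (Fin (d + 1) ↪o Fin R) → ℝ,
      ∀ x, f x = ∑ U, γ U * ((slice S x).submatrix (C U).1 (C U).2).det := by
    intro f hf hfb
    obtain ⟨γ, hγ⟩ := h.exists_cell_sum hb hf hfb
    refine ⟨γ ᵥ* (minorMat A B C)⁻¹, fun x => ?_⟩
    rw [sum_minors_eq hS, Matrix.vecMul_vecMul,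
      Matrix.nonsing_inv_mul _ (isUnit_iff_ne_zero.2 hG), Matrix.vecMul_one, hγ]
  -- Otherwise `v · x` times a facet form would vanish at every vertex and be a combination of the
  -- minors, giving a kernel vector of `interp`.
  have hv : ∀ V, v ⬝ᵥ b V ≠ 0 := by
    intro V h0
    obtain ⟨γ, hγ⟩ := hspan _ (dot_mul_mem_forms (facetForm_mem_forms c V) v) fun V' => by
      by_cases hV : V = V'
      · rw [← hV, h0, zero_mul]
      · rw [hb.facetForm_eq_zero hV, mul_zero]
    have := Matrix.eq_zero_of_mulVec_eq_zero hQ (v := Sum.elim (π V) (-γ)) (by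
      funext y
      have := hγ (pt y)
      simp only [interp_mulVec, Sum.elim_inl, Sum.elim_inr, ← hπ, this]
      simp)
    refine (hb.facetForm_ne_zero_iff V V).2 rfl ?_
    rw [hπ]
    exact Finset.sum_eq_zero fun s _ => by
      rw [show π V s = 0 from congrFun this (Sum.inl s), zero_mul]
  refine ⟨π, ?_, fun V => ⟨hv V, fun i => ?_⟩⟩
  · refine Fintype.linearIndependent_iff.2 fun w hw V => ?_
    refine congrFun (hb.eq_zero_of_sum fun V' => ?_) V
    simp only [hπ, Finset.mul_sum]
    rw [Finset.sum_comm]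
    refine Finset.sum_eq_zero fun s _ => ?_
    have := congrFun hw s
    simp only [Finset.sum_apply, Pi.smul_apply, smul_eq_mul, Pi.zero_apply] at this
    simp only [← mul_assoc]
    rw [← Finset.sum_mul, this, zero_mul]
  -- With this `t`, the form `(x_i - t * (v · x)) * facetForm` vanishes also at `b V`, hence at all
  -- vertices, and lies in the span of the minors.
  · set t := b V i / (v ⬝ᵥ b V) with ht
    obtain ⟨γ, hγ⟩ := hspan _ ((forms k (d + 1)).sub_mem
      (coord_mul_mem_forms (facetForm_mem_forms c V) i)
      (Submodule.smul_mem _ t (dot_mul_mem_forms (facetForm_mem_forms c V) v))) fun V' => by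
        by_cases hV : V = V'
        · subst hV
          simp only [Pi.sub_apply, Pi.smul_apply, smul_eq_mul, ← mul_assoc, ht,
            div_mul_cancel₀ _ (hv V), sub_self]
        · simp [hb.facetForm_eq_zero hV]
    have hX : coordMat pt i *ᵥ π V = interp pt v C S *ᵥ Sum.elim (t • π V) γ := by
      funext y
      have e₁ : (coordMat pt i *ᵥ π V) y = pt y i * facetForm c V.1 (pt y) := by
        rw [hπ, Finset.mul_sum, Matrix.mulVec, dotProduct]
        refine Finset.sum_congr rfl fun s _ => ?_
        simp only [coordMat, Matrix.of_apply]
        ring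
      have e₂ : ∑ s, (t • π V) s * monomial s (pt y) = t * facetForm c V.1 (pt y) := by
        rw [hπ, Finset.mul_sum]
        exact Finset.sum_congr rfl fun s _ => by
          rw [Pi.smul_apply, smul_eq_mul, mul_assoc]
      rw [interp_mulVec, e₁]
      simp only [Sum.elim_inl, Sum.elim_inr]
      rw [e₂, ← hγ (pt y)]
      simp only [Pi.sub_apply, Pi.smul_apply, smul_eq_mul]
      ring
    have hmul : ((interp pt v C S).adjugate * coordMat pt i) *ᵥ π V =
        (interp pt v C S).det • Sum.elim (t • π V) γ := by
      rw [← Matrix.mulVec_mulVec, hX, Matrix.mulVec_mulVec, Matrix.adjugate_mul,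
        Matrix.smul_mulVec, Matrix.one_mulVec]
    funext s
    have := congrFun hmul (Sum.inl s)
    simp only [Pi.smul_apply, Sum.elim_inl, smul_eq_mul, ← mul_assoc] at this
    rw [Pi.smul_apply, smul_eq_mul, ← this]
    rfl

/-- The matrix of the pencil for the linear form `u`. -/
def _root_.CPD.pencilMat (pt : InterpIndex R k d → Fin k → ℝ) (v : Fin k → ℝ)
    (C : MinorChoice I J R (d + 1)) (S : Fin k → Matrix (Fin I) (Fin J) ℝ) (u : Fin k → ℝ) :
    Matrix (Fin (numMonomials k d)) (Fin (numMonomials k d)) ℝ :=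
  ∑ i, u i • mulMat pt v C S i

/-- The determinant of the power sums of the eigenvalues. -/
def _root_.CPD.traceDet {N : ℕ} (L : Matrix (Fin N) (Fin N) ℝ) : ℝ :=
  (Matrix.of fun i j : Fin N => (L ^ ((i : ℕ) + (j : ℕ))).trace).det

/-- The vertex read off from the `s`-th column of a matrix of eigenvectors, up to a factor. -/
def _root_.CPD.vertexOf (pt : InterpIndex R k d → Fin k → ℝ) (v : Fin k → ℝ)
    (C : MinorChoice I J R (d + 1)) (S : Fin k → Matrix (Fin I) (Fin J) ℝ)
    (E : Matrix (Fin (numMonomials k d)) (Fin (numMonomials k d)) ℝ)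
    (s : Fin (numMonomials k d)) : Fin k → ℝ :=
  fun i => (E.adjugate * mulMat pt v C S i * E) s s

theorem pencilMat_mulVec {π : Fin (numMonomials k d) → ℝ} {β : Fin k → ℝ} {κ t : ℝ}
    (hπ : ∀ i, mulMat pt v C S i *ᵥ π = (κ * (β i / t)) • π) (u : Fin k → ℝ) :
    pencilMat pt v C S u *ᵥ π = (κ * (u ⬝ᵥ t⁻¹ • β)) • π := by
  rw [pencilMat, Matrix.sum_mulVec]
  simp only [Matrix.smul_mulVec, hπ, smul_smul]
  rw [← Finset.sum_smul]
  congr 1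
  rw [dotProduct, Finset.mul_sum]
  exact Finset.sum_congr rfl fun i _ => by
    rw [Pi.smul_apply, smul_eq_mul]
    ring

/-- The eigenvalues are distinct once `u` separates the normalized vertices `b V / (v · b V)`. These
differ because their supports differ, and there are fewer than `n + 1` pairs to separate. -/
theorem exists_traceDet_ne_zero (h : Generic (d + 1) A B c)
    (hS : ∀ x, slice S x = weighted A B fun r => c r ⬝ᵥ x) (hQ : (interp pt v C S).det ≠ 0)
    {n : ℕ} (hn : numMonomials k d * numMonomials k d ≤ n) :
    ∃ t : Fin (n * k + 1), traceDet (pencilMat pt v C S fun i => (t : ℝ) ^ (i : ℕ)) ≠ 0 := by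
  obtain ⟨b, hb⟩ := h.exists_isVertexFamily
  obtain ⟨π, hπ, hV⟩ := h.exists_eigenvectors hb hS hQ
  obtain ⟨t, ht⟩ := CPD.exists_separating (k := k) (n := n)
    (α := {p : Facet R d × Facet R d // p.1 ≠ p.2}) (by
      refine (Fintype.card_subtype_le _).trans ?_
      rwa [Fintype.card_prod, ← h.numMonomials_eq_card])
    (fun p => (v ⬝ᵥ b p.1.1)⁻¹ • b p.1.1 - (v ⬝ᵥ b p.1.2)⁻¹ • b p.1.2) (by
      rintro ⟨⟨V, V'⟩, hne⟩ h0
      refine hne (Subtype.ext (Finset.ext fun r => ?_))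
      have h₁ := sub_eq_zero.1 h0
      rw [← hb V r, ← hb V' r]
      have h₂ := congrArg (fun x => c r ⬝ᵥ x) h₁
      simp only [dotProduct_smul, smul_eq_mul] at h₂
      have e₁ := inv_ne_zero (hV V).1
      have e₂ := inv_ne_zero (hV V').1
      constructor
      · intro h₃ h₄
        rw [h₄, mul_zero] at h₂
        exact mul_ne_zero e₁ h₃ h₂
      · intro h₃ h₄
        rw [h₄, mul_zero] at h₂
        exact mul_ne_zero e₂ h₃ h₂.symm)
  refine ⟨t, (det_trace_pow_ne_zero_iff h.numMonomials_eq_card.symm hπ fun V =>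
    pencilMat_mulVec (hV V).2 _).2 fun V V' hVV => ?_⟩
  by_contra hne
  refine ht ⟨(V, V'), hne⟩ ?_
  rw [dotProduct_sub, mul_left_cancel₀ hQ hVV, sub_self]

theorem simplePencil (h : Generic (d + 1) A B c)
    (hS : ∀ x, slice S x = weighted A B fun r => c r ⬝ᵥ x) (hQ : (interp pt v C S).det ≠ 0)
    {u : Fin k → ℝ} (hu : traceDet (pencilMat pt v C S u) ≠ 0) :
    SimplePencil (pencilMat pt v C S u) 1 := by
  obtain ⟨b, hb⟩ := h.exists_isVertexFamily
  obtain ⟨π, hπ, hV⟩ := h.exists_eigenvectors hb hS hQ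
  have hL := fun V => pencilMat_mulVec (hV V).2 u
  exact simplePencil_of_eigenbasis h.numMonomials_eq_card.symm hπ hL
    ((det_trace_pow_ne_zero_iff h.numMonomials_eq_card.symm hπ hL).1 hu)

theorem exists_vertexOf_eq_smul (h : Generic (d + 1) A B c)
    (hS : ∀ x, slice S x = weighted A B fun r => c r ⬝ᵥ x) (hQ : (interp pt v C S).det ≠ 0)
    {u : Fin k → ℝ} (hu : traceDet (pencilMat pt v C S u) ≠ 0)
    {E : Matrix (Fin (numMonomials k d)) (Fin (numMonomials k d)) ℝ}
    {δ : Fin (numMonomials k d) → ℝ} (hE : IsGEVD (pencilMat pt v C S u) 1 E δ)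
    (x : Fin k → ℝ) (hx : (Finset.univ.filter fun r => c r ⬝ᵥ x ≠ 0).card + 1 = d + 1) :
    ∃ s, ∃ t : ℝ, t ≠ 0 ∧ vertexOf pt v C S E s = t • x := by
  classical
  obtain ⟨b₀, hb₀⟩ := h.exists_isVertexFamily
  let V : Facet R d := ⟨Finset.univ.filter fun r => c r ⬝ᵥ x ≠ 0, by omega⟩
  -- Vertices are determined only up to scaling, so the given `x` may serve as the vertex of its own
  -- support.
  let b : Facet R d → Fin k → ℝ := Function.update b₀ V x
  have hb : IsVertexFamily c b := by
    intro V' r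
    by_cases hV' : V' = V
    · subst hV'
      simp [b, V]
    · simp only [b, Function.update_of_ne hV', hb₀ V' r]
  have hbV : b V = x := by simp [b]
  obtain ⟨π, hπ, hV⟩ := h.exists_eigenvectors hb hS hQ
  have hL := fun V => pencilMat_mulVec (hV V).2 u
  obtain ⟨s, t, hs⟩ := exists_col_eq_smul_of_isGEVD h.numMonomials_eq_card.symm hπ hL
    ((det_trace_pow_ne_zero_iff h.numMonomials_eq_card.symm hπ hL).1 hu) hE V
  refine ⟨s, E.det * ((interp pt v C S).det * (v ⬝ᵥ x)⁻¹), mul_ne_zero hE.1.ne_zero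
    (mul_ne_zero hQ (inv_ne_zero (by simpa [hbV] using (hV V).1))), funext fun i => ?_⟩
  rw [vertexOf, adjugate_mul_mul_apply_of_eigenvector
    (μ := (interp pt v C S).det * (b V i / (v ⬝ᵥ b V))), hbV, Pi.smul_apply, smul_eq_mul]
  · ring
  · rw [hs, Matrix.mulVec_smul, (hV V).2 i, smul_comm]

end Generic

/-! ### Reduction to a third factor of full row rank -/

/-- The rows `f l` of `C` are linearly independent. -/
def RowsIndependent {K R k : ℕ} (C : Matrix (Fin K) (Fin R) ℝ) (f : Fin k → Fin K) : Prop :=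
  LinearIndependent ℝ fun l => C.row (f l)

theorem rowsIndependent_iff {K R k : ℕ} {C : Matrix (Fin K) (Fin R) ℝ} {f : Fin k → Fin K} :
    RowsIndependent C f ↔
      ∀ x : Fin k → ℝ, (∀ r, (fun l => C (f l) r) ⬝ᵥ x = 0) → x = 0 := by
  rw [RowsIndependent, Fintype.linearIndependent_iff]
  refine forall_congr' fun x => ⟨fun h hx => funext fun l => h (funext fun r => ?_) l,
    fun h hx l => congrFun (h fun r => ?_) l⟩
  · have := hx r
    simpa [dotProduct, mul_comm, Matrix.row] using this
  · have := congrFun hx r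
    simpa [dotProduct, mul_comm, Matrix.row] using this

theorem exists_rowsIndependent {K R : ℕ} (C : Matrix (Fin K) (Fin R) ℝ) :
    ∃ f : Fin C.rank → Fin K, RowsIndependent C f := by
  obtain ⟨g, hg, -, hi⟩ := Submodule.exists_fun_fin_finrank_span_eq ℝ (Set.range C.row)
  choose f hf using hg
  have hc : C.rank = Module.finrank ℝ (Submodule.span ℝ (Set.range C.row)) :=
    C.rank_eq_finrank_span_row
  refine ⟨fun l => f (finCongr hc l), ?_⟩
  rw [RowsIndependent, funext fun l : Fin C.rank => hf (finCongr hc l)]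
  exact hi.comp _ (finCongr hc).injective

theorem RowsIndependent.le_rank {K R k : ℕ} {C : Matrix (Fin K) (Fin R) ℝ} {f : Fin k → Fin K}
    (h : RowsIndependent C f) : k ≤ C.rank := by
  have h₁ := finrank_span_eq_card h
  rw [Fintype.card_fin] at h₁
  rw [← h₁, C.rank_eq_finrank_span_row]
  refine Submodule.finrank_mono (Submodule.span_mono ?_)
  rintro _ ⟨l, rfl⟩
  exact ⟨f l, rfl⟩

/-- The selected rows span the row space, as there are `C.rank` of them. -/
theorem RowsIndependent.mulVec_eq_zero {K R : ℕ} {C : Matrix (Fin K) (Fin R) ℝ} {k : ℕ}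
    {f : Fin k → Fin K} (h : RowsIndependent C f) (hk : C.rank = k) {z : Fin R → ℝ}
    (hz : C.submatrix f id *ᵥ z = 0) : C *ᵥ z = 0 := by
  have hspan := span_eq_of_linearIndependent h
    (F := Submodule.span ℝ (Set.range C.row)) (fun l => Submodule.subset_span ⟨f l, rfl⟩)
    (by rw [← C.rank_eq_finrank_span_row, hk, Fintype.card_fin])
  funext l
  have hl : C.row l ∈ Submodule.span ℝ (Set.range fun l => C.row (f l)) := by
    rw [hspan]
    exact Submodule.subset_span ⟨l, rfl⟩
  refine Submodule.span_induction (p := fun v _ => v ⬝ᵥ z = 0) ?_ (zero_dotProduct z)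
    (fun _ _ _ _ h₁ h₂ => by rw [add_dotProduct, h₁, h₂, add_zero])
    (fun _ _ _ h => by rw [smul_dotProduct, h, smul_zero]) hl
  rintro _ ⟨i, rfl⟩
  exact congrFun hz i

theorem linearIndependent_cols_of_kRank {K R : ℕ} (C : Matrix (Fin K) (Fin R) ℝ)
    (s : Finset (Fin R)) (hs : s.card = kRank C) :
    LinearIndependent ℝ fun r : s => C.col (r : Fin R) := by
  have : kRank C ∈ {k : ℕ | k ≤ R ∧ ∀ s : Finset (Fin R), s.card = k →
      LinearIndependent ℝ (fun r : s => C.col (r : Fin R))} := by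
    refine Nat.sSup_mem ⟨0, Nat.zero_le R, fun s hs => ?_⟩ ⟨R, fun k hk => hk.1⟩
    rw [Finset.card_eq_zero] at hs
    subst hs
    exact linearIndependent_empty_type
  exact this.2 s hs

/-- A vector orthogonal to `k` shortened columns makes a square submatrix singular. The resulting
relation among these columns extends to all rows of `C` and contradicts its `k`-rank. -/
theorem generalPosition_rows {K R k : ℕ} {C : Matrix (Fin K) (Fin R) ℝ} {f : Fin k → Fin K}
    (h : RowsIndependent C f) (hk : C.rank = k) (hC : kRank C = C.rank) :
    GeneralPosition fun r l => C (f l) r := by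
  intro x hx
  by_contra! hle
  obtain ⟨s, hs, hsc⟩ := Finset.exists_subset_card_eq hle
  have hli := linearIndependent_cols_of_kRank C s (by rw [hC, hk, hsc])
  obtain ⟨U, hU⟩ := exists_orderEmbedding_range hsc
  have hxM : x ᵥ* (C.submatrix f U) = 0 := by
    funext i
    have := hs ((hU (U i)).1 ⟨i, rfl⟩)
    rw [Finset.mem_filter, dotProduct_comm] at this
    exact this.2
  obtain ⟨y, hy, hyM⟩ := Matrix.exists_mulVec_eq_zero_iff.2
    (Matrix.exists_vecMul_eq_zero_iff.1 ⟨x, hx, hxM⟩)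
  set z : Fin R → ℝ := Function.extend U y 0 with hz
  have hzU : ∀ i, z (U i) = y i := fun i => U.injective.extend_apply _ _ _
  have hz0 : ∀ r, r ∉ Set.range U → z r = 0 := fun r hr => by
    rw [hz, Function.extend_apply' _ _ _ (by simpa using hr)]
    rfl
  have hCf : C.submatrix f id *ᵥ z = 0 := by
    funext l
    rw [← congrFun hyM l, Matrix.mulVec, Matrix.mulVec, dotProduct, dotProduct]
    refine (Fintype.sum_of_injective U U.injective _ _ (fun r hr => ?_) fun i => ?_).symm
    · rw [hz0 r hr, mul_zero]
    · rw [hzU]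
      rfl
  have hCz := h.mulVec_eq_zero hk hCf
  have hzs : ∀ r : s, z r = 0 := by
    refine Fintype.linearIndependent_iff.1 hli (fun r : s => z r) (funext fun l => ?_)
    have h₁ := congrFun hCz l
    rw [Matrix.mulVec, dotProduct, ← Finset.sum_subset (Finset.subset_univ s) (fun r _ hr => by
      rw [hz0 r (fun h' => hr ((hU r).1 h')), mul_zero]), ← Finset.sum_coe_sort] at h₁
    simpa [Matrix.col, mul_comm] using h₁
  refine hy (funext fun i => ?_)
  rw [← hzU]
  exact hzs ⟨U i, (hU _).1 ⟨i, rfl⟩⟩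

theorem generic_of_rows {I J K R k d : ℕ} {A : Matrix (Fin I) (Fin R) ℝ}
    {B : Matrix (Fin J) (Fin R) ℝ} {C : Matrix (Fin K) (Fin R) ℝ} {f : Fin k → Fin K}
    (h : RowsIndependent C f) (hk : C.rank = k) (hd : d + 1 = R - C.rank + 2) (hdR : d + 1 ≤ R)
    (hC : kRank C = C.rank)
    (hAB : FullColumnRank (khatriRao (compound (d + 1) A) (compound (d + 1) B))) :
    Generic (d + 1) A B fun r l => C (f l) r := by
  -- Without `C.rank ≤ R` the truncated subtraction in `m` would not give `m + k = R + 2`.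
  have hle := C.rank_le_width
  refine ⟨by omega, by omega, by omega, generalPosition_rows h hk hC, fun w hw => ?_⟩
  refine funext (Fintype.linearIndependent_iff.1 hAB w (funext fun p => ?_))
  simpa [Matrix.col, khatriRao, compound] using hw p.1 p.2

/-! ### Slices of a tensor -/

/-- The frontal slices with numbers `f l`. -/
def frontal {I J K k : ℕ} (T : Tensor I J K) (f : Fin k → Fin K) :
    Fin k → Matrix (Fin I) (Fin J) ℝ :=
  fun l => Matrix.of fun i j => T i j (f l)

theorem slice_frontal_pd {I J K R k : ℕ} (A : Matrix (Fin I) (Fin R) ℝ)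
    (B : Matrix (Fin J) (Fin R) ℝ) (C : Matrix (Fin K) (Fin R) ℝ) (f : Fin k → Fin K)
    (x : Fin k → ℝ) :
    slice (frontal (pd A B C) f) x = weighted A B fun r => (fun l => C (f l) r) ⬝ᵥ x := by
  ext i j
  simp only [slice, frontal, pd, weighted_apply, Matrix.of_apply, dotProduct, Finset.sum_mul,
    Finset.mul_sum]
  rw [Finset.sum_comm]
  exact Finset.sum_congr rfl fun _ _ => Finset.sum_congr rfl fun _ _ => by ring

/-- A minor of the unfolding of `T` along the third mode. -/
def unfoldMinor {I J K k : ℕ} (T : Tensor I J K) (f : Fin k → Fin K)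
    (g : Fin k → Fin I × Fin J) : ℝ :=
  (Matrix.of fun a l => T (g a).1 (g a).2 (f l)).det

/-- A relation among the rows of `C` passes to the corresponding slices. With the converse
`Generic.exists_unfoldMinor_ne_zero`, the rank of `C` can be read off from the tensor. -/
theorem rowsIndependent_of_unfoldMinor {I J K R k : ℕ} {A : Matrix (Fin I) (Fin R) ℝ}
    {B : Matrix (Fin J) (Fin R) ℝ} {C : Matrix (Fin K) (Fin R) ℝ} {f : Fin k → Fin K}
    {g : Fin k → Fin I × Fin J} (h : unfoldMinor (pd A B C) f g ≠ 0) : RowsIndependent C f := by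
  refine rowsIndependent_iff.2 fun x hx => Matrix.eq_zero_of_mulVec_eq_zero h (funext fun a => ?_)
  have := congrFun (congrFun (slice_frontal_pd A B C f x) (g a).1) (g a).2
  simp only [hx] at this
  simpa [slice, frontal, weighted_apply, Matrix.mulVec, dotProduct] using this

namespace Generic

variable {I J K R k m : ℕ} {A : Matrix (Fin I) (Fin R) ℝ} {B : Matrix (Fin J) (Fin R) ℝ}
  {C : Matrix (Fin K) (Fin R) ℝ} {f : Fin k → Fin K}

theorem exists_unfoldMinor_ne_zero (h : Generic m A B fun r l => C (f l) r)
    (hf : RowsIndependent C f) : ∃ g, unfoldMinor (pd A B C) f g ≠ 0 := by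
  refine exists_det_ne_zero (fun (p : Fin I × Fin J) l => pd A B C p.1 p.2 (f l))
    fun w hw => rowsIndependent_iff.1 hf w fun r => ?_
  refine congrFun (h.eq_zero_of_weighted (d := fun r => (fun l => C (f l) r) ⬝ᵥ w) ?_) r
  rw [← slice_frontal_pd]
  ext i j
  exact hw (i, j)

theorem tensorRank_eq (h : Generic m A B fun r l => C (f l) r) :
    tensorRank (pd A B C) = R := by
  refine le_antisymm (Nat.sInf_le ⟨A, B, C, rfl⟩) (le_csInf ⟨R, A, B, C, rfl⟩ ?_)
  rintro R' ⟨A', B', C', hT⟩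
  exact h.le_of_eq (A' := A') (B' := B') (c' := fun r l => C' (f l) r) fun x => by
    rw [← slice_frontal_pd, ← slice_frontal_pd, hT]

/-- Comparing matched terms along one row and one column through a nonzero entry splits `τ r` into
`α r * β r`. Independence of the terms then forces the third scaling to be `(τ r)⁻¹`. -/
theorem factors_eq (h : Generic m A B fun r l => C (f l) r) {A' : Matrix (Fin I) (Fin R) ℝ}
    {B' : Matrix (Fin J) (Fin R) ℝ} {C' : Matrix (Fin K) (Fin R) ℝ}
    (hT : pd A B C = pd A' B' C') :
    ∃ (σ : Equiv.Perm (Fin R)) (α β γ : Fin R → ℝ), ∀ r, α r * β r * γ r = 1 ∧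
      A'.col r = α r • A.col (σ r) ∧ B'.col r = β r • B.col (σ r) ∧
      C'.col r = γ r • C.col (σ r) := by
  obtain ⟨σ, τ, hτ⟩ := h.unique_up_to_third (A' := A') (B' := B')
    (c' := fun r l => C' (f l) r) fun x => by
      rw [← slice_frontal_pd, ← slice_frontal_pd, hT]
  have hAB : ∀ r, ∃ α β : ℝ, α * β = τ r ∧ A'.col r = α • A.col (σ r) ∧
      B'.col r = β • B.col (σ r) := by
    intro r
    obtain ⟨hτ0, hτr⟩ := hτ r
    obtain ⟨i₀, j₀, h₀⟩ := h.exists_term_ne_zero (σ r)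
    have h₁ : A' i₀ r * B' j₀ r ≠ 0 := by
      rw [hτr]
      exact mul_ne_zero hτ0 h₀
    have hA' := left_ne_zero_of_mul h₁
    have hB' := right_ne_zero_of_mul h₁
    refine ⟨τ r * B j₀ (σ r) / B' j₀ r, τ r * A i₀ (σ r) / A' i₀ r, ?_, ?_, ?_⟩
    · rw [div_mul_div_comm, div_eq_iff (mul_ne_zero hB' hA')]
      linear_combination (-τ r) * hτr i₀ j₀
    · funext i
      rw [Pi.smul_apply, smul_eq_mul, div_mul_eq_mul_div, eq_div_iff hB']
      simp only [Matrix.col_apply]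
      linear_combination hτr i j₀
    · funext j
      rw [Pi.smul_apply, smul_eq_mul, div_mul_eq_mul_div, eq_div_iff hA']
      simp only [Matrix.col_apply]
      linear_combination hτr i₀ j
  choose α β hαβ hA hB using hAB
  have hC : ∀ l r, C l r = τ (σ.symm r) * C' l (σ.symm r) := by
    intro l r
    refine sub_eq_zero.1 (congrFun (h.eq_zero_of_weighted
      (d := fun r => C l r - τ (σ.symm r) * C' l (σ.symm r)) ?_) r)
    ext i j
    have h₁ := congrFun (congrFun (congrFun hT i) j) l
    simp only [pd] at h₁
    simp only [weighted_apply, mul_sub, Finset.sum_sub_distrib, h₁, Matrix.zero_apply]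
    rw [sub_eq_zero, ← Equiv.sum_comp σ fun r => A i r * B j r *
      (τ (σ.symm r) * C' l (σ.symm r))]
    refine Finset.sum_congr rfl fun q _ => ?_
    rw [Equiv.symm_apply_apply, (hτ q).2]
    ring
  refine ⟨σ, α, β, fun r => (τ r)⁻¹, fun r => ⟨?_, hA r, hB r, ?_⟩⟩
  · rw [hαβ, mul_inv_cancel₀ (hτ r).1]
  · funext l
    rw [Pi.smul_apply, Matrix.col_apply, Matrix.col_apply, hC, Equiv.symm_apply_apply,
      smul_eq_mul, inv_mul_cancel_left₀ (hτ r).1]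

/-- Both decompositions are compared with the given one; the scalings can be divided since their
products are `1`. -/
theorem cpdUnique (h : Generic m A B fun r l => C (f l) r) : CPDUnique (pd A B C) := by
  rintro R' A₁ A₂ B₁ B₂ C₁ C₂ ⟨h₁, hR⟩ ⟨h₂, -⟩
  rw [h.tensorRank_eq] at hR
  subst hR
  obtain ⟨σ₁, α₁, β₁, γ₁, e₁⟩ := h.factors_eq h₁
  obtain ⟨σ₂, α₂, β₂, γ₂, e₂⟩ := h.factors_eq h₂
  have hne : ∀ r, α₁ r ≠ 0 ∧ β₁ r ≠ 0 ∧ γ₁ r ≠ 0 := fun r => by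
    have := (e₁ r).1
    refine ⟨fun h0 => ?_, fun h0 => ?_, fun h0 => ?_⟩ <;> simp [h0] at this
  refine ⟨σ₂.trans σ₁.symm, fun r => α₂ r / α₁ (σ₁.symm (σ₂ r)),
    fun r => β₂ r / β₁ (σ₁.symm (σ₂ r)), fun r => γ₂ r / γ₁ (σ₁.symm (σ₂ r)), fun r => ?_⟩
  obtain ⟨n₁, n₂, n₃⟩ := hne (σ₁.symm (σ₂ r))
  obtain ⟨p₁, a₁, b₁, c₁⟩ := e₁ (σ₁.symm (σ₂ r))
  obtain ⟨p₂, a₂, b₂, c₂⟩ := e₂ r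
  rw [Equiv.apply_symm_apply] at a₁ b₁ c₁
  simp only [Equiv.trans_apply]
  refine ⟨?_, ?_, ?_, ?_⟩
  · rw [div_mul_div_comm, div_mul_div_comm, p₁, p₂, div_one]
  · rw [a₁, a₂, smul_smul, div_mul_cancel₀ _ n₁]
  · rw [b₁, b₂, smul_smul, div_mul_cancel₀ _ n₂]
  · rw [c₁, c₂, smul_smul, div_mul_cancel₀ _ n₃]

end Generic

/-! ### Recovering the factors from the rank-one terms -/

/-- The matrix of the entries of the matrices `X r` at the positions `g`. -/
def entryMat {I J R : ℕ} (X : Fin R → Matrix (Fin I) (Fin J) ℝ) (g : Fin R → Fin I × Fin J) :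
    Matrix (Fin R) (Fin R) ℝ :=
  Matrix.of fun q r => X r (g q).1 (g q).2

/-- Common denominator of the third factor. -/
def denom {I J R : ℕ} (X : Fin R → Matrix (Fin I) (Fin J) ℝ)
    (g pos : Fin R → Fin I × Fin J) : ℝ :=
  (entryMat X g).det * ∏ r, X r (pos r).1 (pos r).2

/-- Numerators of the third factor. -/
def numer {I J K R : ℕ} (T : Tensor I J K) (X : Fin R → Matrix (Fin I) (Fin J) ℝ)
    (g pos : Fin R → Fin I × Fin J) (l : Fin K) (r : Fin R) : ℝ :=
  (∑ q, (entryMat X g).adjugate r q * T (g q).1 (g q).2 l) *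
    ∏ q ∈ Finset.univ.erase r, X q (pos q).1 (pos q).2

/-- A rank-one matrix is a column times a row divided by their common entry, taken at `pos r`. The
third factor solves a linear system in the entries at `g`, by Cramer's rule; all denominators are
collected in `denom`. -/
theorem Generic.exists_recovery {I J K R k m : ℕ} {A : Matrix (Fin I) (Fin R) ℝ}
    {B : Matrix (Fin J) (Fin R) ℝ} {c : Fin R → Fin k → ℝ} (h : Generic m A B c)
    (C : Matrix (Fin K) (Fin R) ℝ) {X : Fin R → Matrix (Fin I) (Fin J) ℝ} {κ : Fin R → ℝ}
    (hκ : ∀ r, κ r ≠ 0) (hX : ∀ r i j, X r i j = κ r * (A i r * B j r)) :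
    ∃ g pos, denom X g pos ≠ 0 ∧ ∀ i j l, pd A B C i j l * denom X g pos =
      ∑ r, X r i (pos r).2 * X r (pos r).1 j * numer (pd A B C) X g pos l r := by
  obtain ⟨g, hg⟩ := exists_det_ne_zero (fun (p : Fin I × Fin J) r => X r p.1 p.2) fun w hw => by
    have := h.eq_zero_of_weighted (d := fun r => κ r * w r) (by
      ext i j
      rw [Matrix.zero_apply, ← hw (i, j), weighted_apply]
      exact Finset.sum_congr rfl fun r _ => by rw [hX]; ring)
    funext r
    exact (mul_eq_zero.1 (congrFun this r)).resolve_left (hκ r)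
  choose i₀ j₀ h₀ using h.exists_term_ne_zero
  have hpos : ∀ r, X r (i₀ r) (j₀ r) ≠ 0 := fun r => by
    rw [hX]
    exact mul_ne_zero (hκ r) (h₀ r)
  refine ⟨g, fun r => (i₀ r, j₀ r), mul_ne_zero hg (Finset.prod_ne_zero_iff.2 fun r _ => hpos r),
    fun i j l => ?_⟩
  have hT : (fun q => pd A B C (g q).1 (g q).2 l) = entryMat X g *ᵥ fun r => C l r / κ r := by
    funext q
    refine Finset.sum_congr rfl fun r _ => ?_
    simp only [entryMat, Matrix.of_apply, hX]
    have := hκ r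
    field_simp
  have hadj : ∀ r, ∑ q, (entryMat X g).adjugate r q * pd A B C (g q).1 (g q).2 l =
      (entryMat X g).det * (C l r / κ r) := by
    intro r
    have h₁ : ((entryMat X g).adjugate *ᵥ fun q => pd A B C (g q).1 (g q).2 l) r =
        (entryMat X g).det * (C l r / κ r) := by
      rw [hT, Matrix.mulVec_mulVec, Matrix.adjugate_mul, Matrix.smul_mulVec, Matrix.one_mulVec]
      rfl
    exact h₁
  rw [pd, Finset.sum_mul]
  refine Finset.sum_congr rfl fun r _ => ?_
  rw [numer, hadj, denom, ← Finset.mul_prod_erase Finset.univ _ (Finset.mem_univ r), hX r i,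
    hX r _ j, hX r (i₀ r)]
  have := hκ r
  field_simp

/-! ### Computability of the ingredients -/

namespace Computes

variable {ι : Type} {I J K k R d : ℕ}

theorem const_of_rat {r : ℝ} (h : ∃ q : ℚ, r = q) : Computes fun _ : ι → ℝ => r := by
  obtain ⟨q, rfl⟩ := h
  exact rat q

theorem slice {S : (ι → ℝ) → Fin k → Matrix (Fin I) (Fin J) ℝ} {β : (ι → ℝ) → Fin k → ℝ}
    (hS : ∀ l i j, Computes fun x => S x l i j) (hβ : ∀ l, Computes fun x => β x l)
    (i : Fin I) (j : Fin J) : Computes fun x => CPD.slice (S x) (β x) i j := by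
  simp only [CPD.slice, Matrix.of_apply]
  exact sum _ fun l => mul (hS l i j) (hβ l)

theorem extract {M₀ M₁ : (ι → ℝ) → Matrix (Fin I) (Fin J) ℝ}
    (h₀ : ∀ i j, Computes fun x => M₀ x i j) (h₁ : ∀ i j, Computes fun x => M₁ x i j) {m : ℕ}
    (e : Fin m → Fin I) (e' : Fin m → Fin J) (i : Fin I) (j : Fin J) :
    Computes fun x => CPD.extract (M₀ x) (M₁ x) e e' i j := by
  unfold CPD.extract
  exact matrix_mul (fun _ _ => matrix_mul (fun _ _ => h₀ _ _)
    (fun _ _ => adjugate (fun _ _ => h₁ _ _) _ _) _ _) (fun _ _ => h₀ _ _) _ _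

theorem interp {pt : InterpIndex R k d → Fin k → ℚ} {v : Fin k → ℚ}
    (C : MinorChoice I J R (d + 1)) {S : (ι → ℝ) → Fin k → Matrix (Fin I) (Fin J) ℝ}
    (hS : ∀ l i j, Computes fun x => S x l i j) (y y' : InterpIndex R k d) :
    Computes fun x => CPD.interp (fun y i => (pt y i : ℝ)) (fun i => (v i : ℝ)) C (S x) y y' := by
  rcases y' with s | U
  · refine const_of_rat ?_
    obtain ⟨q, hq⟩ := exists_rat_monomial s (pt y)
    refine ⟨(∑ i, v i * pt y i) * q, ?_⟩
    rw [Rat.cast_mul, Rat.cast_sum, ← hq]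
    simp only [Rat.cast_mul]
    rfl
  · exact det fun _ _ => slice hS (fun l => rat (pt y l)) _ _

theorem mulMat {pt : InterpIndex R k d → Fin k → ℚ} {v : Fin k → ℚ}
    (C : MinorChoice I J R (d + 1)) {S : (ι → ℝ) → Fin k → Matrix (Fin I) (Fin J) ℝ}
    (hS : ∀ l i j, Computes fun x => S x l i j) (i : Fin k) (s t : Fin (numMonomials k d)) :
    Computes fun x =>
      CPD.mulMat (fun y i => (pt y i : ℝ)) (fun i => (v i : ℝ)) C (S x) i s t := by
  have hc : ∀ y t, Computes fun _ : ι → ℝ => coordMat (fun y i => (pt y i : ℝ)) i y t := by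
    intro y t
    obtain ⟨q, hq⟩ := exists_rat_monomial t (pt y)
    exact const_of_rat ⟨pt y i * q, by rw [Rat.cast_mul, ← hq]; rfl⟩
  exact matrix_mul (M' := fun _ => coordMat (fun y i => (pt y i : ℝ)) i)
    (adjugate (interp (v := v) C hS)) hc (Sum.inl s) t

theorem pencilMat {pt : InterpIndex R k d → Fin k → ℚ} {v u : Fin k → ℚ}
    (C : MinorChoice I J R (d + 1)) {S : (ι → ℝ) → Fin k → Matrix (Fin I) (Fin J) ℝ}
    (hS : ∀ l i j, Computes fun x => S x l i j) (s t : Fin (numMonomials k d)) :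
    Computes fun x => CPD.pencilMat (fun y i => (pt y i : ℝ)) (fun i => (v i : ℝ)) C (S x)
      (fun i => (u i : ℝ)) s t := by
  simp only [CPD.pencilMat, Matrix.sum_apply, Matrix.smul_apply, smul_eq_mul]
  exact sum _ fun i => mul (rat (u i)) (mulMat C hS i s t)

theorem traceDet {N : ℕ} {L : (ι → ℝ) → Matrix (Fin N) (Fin N) ℝ}
    (hL : ∀ s t, Computes fun x => L x s t) : Computes fun x => CPD.traceDet (L x) := by
  refine det fun i j => ?_
  simp only [Matrix.of_apply, Matrix.trace, Matrix.diag_apply]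
  exact sum _ fun s => matrix_pow hL _ s s

theorem vertexOf {pt : InterpIndex R k d → Fin k → ℚ} {v : Fin k → ℚ}
    (C : MinorChoice I J R (d + 1)) {S : (ι → ℝ) → Fin k → Matrix (Fin I) (Fin J) ℝ}
    (hS : ∀ l i j, Computes fun x => S x l i j)
    {E : (ι → ℝ) → Matrix (Fin (numMonomials k d)) (Fin (numMonomials k d)) ℝ}
    (hE : ∀ s t, Computes fun x => E x s t) (s : Fin (numMonomials k d)) (i : Fin k) :
    Computes fun x =>
      CPD.vertexOf (fun y i => (pt y i : ℝ)) (fun i => (v i : ℝ)) C (S x) (E x) s i :=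
  matrix_mul (fun _ _ => matrix_mul (fun _ _ => adjugate hE _ _)
    (fun _ _ => mulMat C hS i _ _) _ _) hE s s

theorem denom {X : (ι → ℝ) → Fin R → Matrix (Fin I) (Fin J) ℝ}
    (hX : ∀ r i j, Computes fun x => X x r i j) (g pos : Fin R → Fin I × Fin J) :
    Computes fun x => CPD.denom (X x) g pos :=
  mul (det fun _ _ => hX _ _ _) (prod _ fun _ => hX _ _ _)

theorem numer {T : (ι → ℝ) → Tensor I J K} {X : (ι → ℝ) → Fin R → Matrix (Fin I) (Fin J) ℝ}
    (hT : ∀ i j l, Computes fun x => T x i j l) (hX : ∀ r i j, Computes fun x => X x r i j)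
    (g pos : Fin R → Fin I × Fin J) (l : Fin K) (r : Fin R) :
    Computes fun x => CPD.numer (T x) (X x) g pos l r :=
  mul (sum _ fun _ => mul (adjugate (fun _ _ => hX _ _ _) _ _) (hT _ _ _))
    (prod _ fun _ => hX _ _ _)

end Computes

/-! ### The procedure -/

theorem Realizable.mono {κ ι : Type} {D D' : Set (ι → ℝ)}
    {Post : (ι → ℝ) → (κ → ℝ) → Prop} (h : Realizable D' Post) (hD : D ⊆ D') :
    Realizable D Post :=
  h.imp fun _ hP x hx => hP x (hD hx)

/-- The tensor with the entries `x`. -/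
def toTensor {I J K : ℕ} (x : Fin I × Fin J × Fin K → ℝ) : Tensor I J K :=
  fun i j l => x (i, j, l)

/-- The result `y` lists the factors of a canonical polyadic decomposition of `T`. -/
def IsCPDResult {I J K R : ℕ} (T : Tensor I J K)
    (y : (Fin I × Fin R) ⊕ ((Fin J × Fin R) ⊕ (Fin K × Fin R)) → ℝ) : Prop :=
  IsCPD T (Matrix.of fun i r => y (Sum.inl (i, r)))
    (Matrix.of fun j r => y (Sum.inr (Sum.inl (j, r))))
    (Matrix.of fun l r => y (Sum.inr (Sum.inr (l, r))))

section Procedures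

variable {ι : Type} {I J K R : ℕ} {D : Set (ι → ℝ)} {T : (ι → ℝ) → Tensor I J K}

/-- Guess the data for the recovery of the factors from matrices proportional to the rank-one
terms, and check the result. -/
theorem realizable_of_terms {σ : Type} [Finite σ] (hT : ∀ i j l, Computes fun x => T x i j l)
    (hrank : ∀ x ∈ D, tensorRank (T x) = R) (M : σ → (ι → ℝ) → Matrix (Fin I) (Fin J) ℝ)
    (hM : ∀ s i j, Computes fun x => M s x i j)
    (h : ∀ x ∈ D, ∃ (s : Fin R → σ) (g pos : Fin R → Fin I × Fin J),
      denom (fun r => M (s r) x) g pos ≠ 0 ∧ ∀ i j l, T x i j l *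
        denom (fun r => M (s r) x) g pos = ∑ r, M (s r) x i (pos r).2 * M (s r) x (pos r).1 j *
          numer (T x) (fun r => M (s r) x) g pos l r) :
    Realizable D fun x => IsCPDResult (R := R) (T x) := by
  refine Realizable.of_cases (α := (Fin R → σ) × (Fin R → Fin I × Fin J) ×
      (Fin R → Fin I × Fin J)) (fun a x => denom (fun r => M (a.1 r) x) a.2.1 a.2.2 ≠ 0 ∧
      ∀ i j l, T x i j l * denom (fun r => M (a.1 r) x) a.2.1 a.2.2 =
        ∑ r, M (a.1 r) x i (a.2.2 r).2 * M (a.1 r) x (a.2.2 r).1 j *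
          numer (T x) (fun r => M (a.1 r) x) a.2.1 a.2.2 l r) ?_ ?_ ?_
  · rintro ⟨s, g, pos⟩
    have hX : ∀ r i j, Computes fun x => M (s r) x i j := fun r => hM (s r)
    have hden := Computes.denom hX g pos
    refine (Decides.ne_zero hden).and (Decides.forall_finite fun i => Decides.forall_finite
      fun j => Decides.forall_finite fun l => Decides.eq ((hT i j l).mul hden)
      (Computes.sum _ fun r => ((hX _ _ _).mul (hX _ _ _)).mul (Computes.numer hT hX _ _ _ _)))
  · intro x hx
    obtain ⟨s, g, pos, h⟩ := h x hx
    exact ⟨(s, g, pos), h⟩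
  · rintro ⟨s, g, pos⟩
    have hX : ∀ r i j, Computes fun x => M (s r) x i j := fun r => hM (s r)
    refine Realizable.of_inv (Computes.denom hX g pos) (fun x hx => hx.2.1) ?_
    refine Realizable.of_computes (fun o y => Sum.elim
      (fun p => M (s p.2) (fun i => y (some i)) p.1 (pos p.2).2)
      (Sum.elim (fun p => M (s p.2) (fun i => y (some i)) (pos p.2).1 p.1)
        (fun p => numer (T fun i => y (some i)) (fun r => M (s r) fun i => y (some i)) g pos p.1
          p.2 * y none)) o) ?_ ?_
    · rintro (p | p | p)
      · exact (hM _ _ _).comap some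
      · exact (hM _ _ _).comap some
      · exact ((Computes.numer hT hX g pos p.1 p.2).comap some).mul (Computes.proj none)
    · rintro y ⟨⟨hy, hden, heq⟩, hinv⟩
      -- The test certifies a decomposition with `R` terms, and minimality is known in advance, so
      -- no labels need to be verified.
      refine ⟨?_, hrank _ hy⟩
      funext i j l
      simp only [pd, Matrix.of_apply, Sum.elim_inl, Sum.elim_inr, hinv, ← mul_assoc]
      rw [← Finset.sum_mul, ← heq, mul_inv_cancel_right₀ hden]

/-- Nested searches for `v` with the minors, then for `u`, are followed by one GEVD with the
identity as second matrix and the recovery of the factors. All auxiliary points are rational and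
fixed beforehand. -/
theorem realizable_of_generic {k d : ℕ} (hT : ∀ i j l, Computes fun x => T x i j l)
    (f : Fin k → Fin K)
    (hD : ∀ x ∈ D, ∃ (A : Matrix (Fin I) (Fin R) ℝ) (B : Matrix (Fin J) (Fin R) ℝ)
      (C : Matrix (Fin K) (Fin R) ℝ), T x = pd A B C ∧
        Generic (d + 1) A B fun r l => C (f l) r) :
    Realizable D fun x => IsCPDResult (R := R) (T x) := by
  by_cases hne : D = ∅
  · refine Realizable.of_cases (α := Empty) (fun a => a.elim) (fun a => a.elim) ?_
      fun a => a.elim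
    simp [hne]
  -- One member of `D` supplies the relation between `k`, `d` and `R` needed to fix the
  -- interpolation points for all inputs.
  obtain ⟨x₀, hx₀⟩ := Set.nonempty_iff_ne_empty.2 hne
  obtain ⟨A₀, B₀, C₀, -, h₀⟩ := hD x₀ hx₀
  obtain ⟨pt, hpt⟩ := exists_unisolvent k (d + 1) (Y := InterpIndex R k d)
    h₀.numMonomials_succ.le
  set P : InterpIndex R k d → Fin k → ℝ := fun y i => (pt y i : ℝ) with hP
  set N := numMonomials k d with hN
  set w : ℕ → Fin k → ℚ := fun t i => (t : ℚ) ^ (i : ℕ) with hw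
  have hwR : ∀ t : ℕ, (fun i : Fin k => (t : ℝ) ^ (i : ℕ)) = fun i => (w t i : ℝ) := fun t => by
    funext i
    simp [hw]
  have hS : ∀ l i j, Computes fun x => frontal (T x) f l i j := fun l i j => hT i j (f l)
  refine Realizable.of_cases (α := Fin (N * k + 1) × MinorChoice I J R (d + 1))
    (fun a x => (interp P (fun i => (w a.1 i : ℝ)) a.2 (frontal (T x) f)).det ≠ 0)
    (fun a => Decides.ne_zero (Computes.det (Computes.interp a.2 hS))) (fun x hx => ?_) ?_
  · obtain ⟨A, B, C, hTx, h⟩ := hD x hx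
    obtain ⟨b, hb⟩ := h.exists_isVertexFamily
    obtain ⟨t, ht⟩ := h.exists_separating hb le_rfl
    obtain ⟨Q, hQ⟩ := h.exists_minorChoice (S := frontal (T x) f) hb hpt fun x => by
      rw [hTx, slice_frontal_pd]
    rw [hwR] at ht
    exact ⟨(t, Q), hQ _ ht⟩
  rintro ⟨tv, Q⟩
  set v : Fin k → ℝ := fun i => (w tv i : ℝ) with hv
  refine Realizable.of_cases (α := Fin (N * N * k + 1))
    (fun t x => traceDet (pencilMat P v Q (frontal (T x) f) fun i => (w t i : ℝ)) ≠ 0)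
    (fun t => Decides.ne_zero (Computes.traceDet (Computes.pencilMat Q hS)))
    (fun x hx => ?_) fun tu => ?_
  · obtain ⟨A, B, C, hTx, h⟩ := hD x hx.1
    obtain ⟨t, ht⟩ := h.exists_traceDet_ne_zero (S := frontal (T x) f) (fun x => by
      rw [hTx, slice_frontal_pd]) hx.2 le_rfl
    rw [hwR] at ht
    exact ⟨t, ht⟩
  refine Realizable.of_gevd (M₁ := fun x => pencilMat P v Q (frontal (T x) f)
    fun i => (w tu i : ℝ)) (M₂ := fun _ => 1) (Computes.pencilMat Q hS) (fun a b => ?_)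
    (fun x hx => ?_) ?_
  · by_cases hab : a = b
    · exact Computes.const_of_rat ⟨1, by rw [hab, Matrix.one_apply_eq, Rat.cast_one]⟩
    · exact Computes.const_of_rat ⟨0, by rw [Matrix.one_apply_ne hab, Rat.cast_zero]⟩
  · obtain ⟨A, B, C, hTx, h⟩ := hD x hx.1.1
    exact h.simplePencil (fun x => by rw [hTx, slice_frontal_pd]) hx.1.2 hx.2
  let S : (ι ⊕ (Fin N × Fin N) → ℝ) → Fin k → Matrix (Fin I) (Fin J) ℝ :=
    fun y => frontal (T fun i => y (Sum.inl i)) f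
  let E : (ι ⊕ (Fin N × Fin N) → ℝ) → Matrix (Fin N) (Fin N) ℝ :=
    fun y => Matrix.of fun a b => y (Sum.inr (a, b))
  have hSy : ∀ l i j, Computes fun y => S y l i j := fun l i j => (hS l i j).comap Sum.inl
  have hβ : ∀ s l, Computes fun y => vertexOf P v Q (S y) (E y) s l :=
    Computes.vertexOf Q hSy fun a b => Computes.proj (Sum.inr (a, b))
  -- The GEVD returns unlabelled vertices, so every pair of them and every position of a minor is a
  -- candidate for a rank-one term.
  refine realizable_of_terms (σ := Fin N × Fin N × (Fin (d + 1) → Fin I) ×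
    (Fin (d + 1) → Fin J)) (fun i j l => (hT i j l).comap Sum.inl) (fun y hy => ?_)
    (fun s y => extract (slice (S y) (vertexOf P v Q (S y) (E y) s.1))
      (slice (S y) (vertexOf P v Q (S y) (E y) s.2.1)) s.2.2.1 s.2.2.2)
    (fun s => Computes.extract (Computes.slice hSy (hβ _)) (Computes.slice hSy (hβ _)) _ _)
    fun y hy => ?_
  · obtain ⟨A, B, C, hTx, h⟩ := hD _ hy.1.1.1
    rw [hTx]
    exact h.tensorRank_eq
  · obtain ⟨⟨⟨hyD, hdet⟩, htr⟩, δ, hE⟩ := hy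
    obtain ⟨A, B, C, hTx, h⟩ := hD _ hyD
    have hsl : ∀ x, slice (S y) x = weighted A B fun r => (fun l => C (f l) r) ⬝ᵥ x :=
      fun x => by
        change slice (frontal (T fun i => y (Sum.inl i)) f) x = _
        rw [hTx, slice_frontal_pd]
    choose s₀ s₁ e e' κ hκ hX using h.exists_extract (vertexOf P v Q (S y) (E y))
      (h.exists_vertexOf_eq_smul hsl hdet htr hE)
    obtain ⟨g, pos, hgp⟩ := h.exists_recovery C (X := fun r =>
      extract (slice (S y) (vertexOf P v Q (S y) (E y) (s₀ r)))
        (slice (S y) (vertexOf P v Q (S y) (E y) (s₁ r))) (e r) (e' r)) hκ fun r i j => by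
      rw [hsl, hsl, hX]
    refine ⟨fun r => (s₀ r, s₁ r, e r, e' r), g, pos, ?_⟩
    rw [hTx]
    exact hgp

end Procedures

/-- The hypotheses of the theorem. -/
def Admissible {I J K R : ℕ} (A : Matrix (Fin I) (Fin R) ℝ) (B : Matrix (Fin J) (Fin R) ℝ)
    (C : Matrix (Fin K) (Fin R) ℝ) : Prop :=
  R - C.rank + 2 ≤ R ∧ kRank C = C.rank ∧
    FullColumnRank (khatriRao (compound (R - C.rank + 2) A) (compound (R - C.rank + 2) B))

theorem Admissible.generic {I J K R k : ℕ} {A : Matrix (Fin I) (Fin R) ℝ}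
    {B : Matrix (Fin J) (Fin R) ℝ} {C : Matrix (Fin K) (Fin R) ℝ} (h : Admissible A B C)
    {f : Fin k → Fin K} (hf : RowsIndependent C f) (hk : C.rank = k) :
    Generic (R + 1 - k + 1) A B fun r l => C (f l) r := by
  have hle := C.rank_le_width
  have e : R + 1 - k + 1 = R - C.rank + 2 := by omega
  refine generic_of_rows hf hk e (by rw [e]; exact h.1) h.2.1 ?_
  rw [e]
  exact h.2.2

/-- The rank of `C` is not part of the input. It is found as the largest size of a nonzero minor of
the third unfolding, which also selects the independent rows of `C`. -/
theorem exists_procedure (I J K R : ℕ) :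
    ∃ P : TensorProcedure I J K R, ∀ (A : Matrix (Fin I) (Fin R) ℝ)
      (B : Matrix (Fin J) (Fin R) ℝ) (C : Matrix (Fin K) (Fin R) ℝ), Admissible A B C →
      P.FindsCPD (pd A B C) := by
  suffices H : Realizable {x : Fin I × Fin J × Fin K → ℝ | ∃ (A : Matrix (Fin I) (Fin R) ℝ)
      (B : Matrix (Fin J) (Fin R) ℝ) (C : Matrix (Fin K) (Fin R) ℝ), Admissible A B C ∧
      toTensor x = pd A B C} fun x => IsCPDResult (R := R) (toTensor x) by
    obtain ⟨P, hP⟩ := H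
    exact ⟨P, fun A B C h => hP (fun p => pd A B C p.1 p.2.1 p.2.2) ⟨A, B, C, h, rfl⟩⟩
  have hT : ∀ (i : Fin I) (j : Fin J) (l : Fin K), Computes fun x => toTensor x i j l :=
    fun i j l => Computes.proj (i, j, l)
  have hminor : ∀ {k : ℕ} (f : Fin k → Fin K) (g : Fin k → Fin I × Fin J),
      Computes fun x => unfoldMinor (toTensor x) f g :=
    fun f g => Computes.det fun a l => hT _ _ _
  refine Realizable.of_cases
    (α := (k : Fin (K + 1)) × (Fin k → Fin K) × (Fin k → Fin I × Fin J))
    (fun a x => unfoldMinor (toTensor x) a.2.1 a.2.2 ≠ 0 ∧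
      ∀ b : (k : Fin (K + 1)) × (Fin k → Fin K) × (Fin k → Fin I × Fin J),
        (a.1 < b.1 → unfoldMinor (toTensor x) b.2.1 b.2.2 = 0)) (fun a => ?_) ?_ fun a => ?_
  · refine (Decides.ne_zero (hminor _ _)).and (Decides.forall_finite fun b => ?_)
    by_cases hab : a.1 < b.1
    · simpa [hab] using Decides.eq_zero (hminor b.2.1 b.2.2)
    · exact fun κ P Q => ⟨P, fun x post hP _ => hP fun h => absurd h hab⟩
  · rintro x ⟨A, B, C, h, hx⟩
    obtain ⟨f, hf⟩ := exists_rowsIndependent C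
    obtain ⟨g, hg⟩ := (h.generic hf rfl).exists_unfoldMinor_ne_zero hf
    refine ⟨⟨⟨C.rank, Nat.lt_succ_of_le C.rank_le_height⟩, f, g⟩, by rw [hx]; exact hg,
      fun b hb => ?_⟩
    by_contra hne
    rw [hx] at hne
    exact absurd (rowsIndependent_of_unfoldMinor hne).le_rank (not_le.2 hb)
  · obtain ⟨k, f, g⟩ := a
    -- Here `d = m - 1`, as `m = R - k + 2`.
    refine realizable_of_generic (k := k) (d := R + 1 - k) hT f ?_
    rintro x ⟨⟨A, B, C, h, hx⟩, hne, hmax⟩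
    refine ⟨A, B, C, hx, ?_⟩
    simp only [hx] at hne hmax
    have hf := rowsIndependent_of_unfoldMinor hne
    refine h.generic hf (le_antisymm ?_ hf.le_rank)
    by_contra! hlt
    obtain ⟨f', hf'⟩ := exists_rowsIndependent C
    obtain ⟨g', hg'⟩ := (h.generic hf' rfl).exists_unfoldMinor_ne_zero hf'
    exact hg' (hmax ⟨⟨C.rank, Nat.lt_succ_of_le C.rank_le_height⟩, f', g'⟩ hlt)

end CPD

end

theorem theorem1p6 (I J K R : ℕ) :
    ∃ P : CPD.TensorProcedure I J K R,
      ∀ (A : Matrix (Fin I) (Fin R) ℝ) (B : Matrix (Fin J) (Fin R) ℝ)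
        (C : Matrix (Fin K) (Fin R) ℝ) (T : CPD.Tensor I J K) (m : ℕ),
        T = CPD.pd A B C →
        m = R - C.rank + 2 →
        m ≤ R →
        CPD.kRank C = C.rank →
        CPD.FullColumnRank (CPD.khatriRao (CPD.compound m A) (CPD.compound m B)) →
        CPD.tensorRank T = R ∧ CPD.CPDUnique T ∧ P.FindsCPD T := by
  obtain ⟨P, hP⟩ := CPD.exists_procedure I J K R
  refine ⟨P, ?_⟩
  rintro A B C _ _ rfl rfl hm hC hAB
  have h : CPD.Admissible A B C := ⟨hm, hC, hAB⟩
  obtain ⟨f, hf⟩ := CPD.exists_rowsIndependent C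
  have hg := h.generic hf rfl
  exact ⟨hg.tensorRank_eq, hg.cpdUnique, hP A B C h⟩
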